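/- **Setting.** Let $n,m\ge 1$, let $A_*\in\mathbb R^{n\times n}$, $B_*\in\mathbb R^{n\times m}$, $\theta_*=(A_*,B_*)\in\mathbb R^{n\times(n+m)}$, and consider $$x_{t+1}=A_*x_t+B_*u_t+w_t,\qquad u_t=\pi_t\big(x_t,\{x_s,u_s,\eta_s\}_{s=0}^{t-1}\big)+\eta_t,\qquad t\ge 0,$$ where the $\pi_t$ are arbitrary measurable functions (possibly nonlinear, time-varying and history-dependent). Suppose: - $(w_t)_{t\ge0}$ is i.i.d. in $\mathbb R^n$ with mean zero, $\|w_t\|_2\le w_{\max}$ a.s., and the minimum eigenvalue of $\mathrm{cov}(w_t)$ is at least $\sigma_w^2>0$; - $(\eta_t)_{t\ge0}$ is i.i.d. in $\mathbb R^m$ with mean zero, $\|\eta_t\|_2\le \eta_{\max}$ a.s., and the minimum eigenvalue of $\mathrm{cov}(\eta_t)$ is at least $\sigma_\eta^2>0$; - the initial state $x_0$ (deterministic or random), the sequence $(w_t)$ and the sequence $(\eta_t)$ are mutually independent; - almost surely, $\sqrt{\|x_t\|_2^2+\|u_t\|_2^2}\le b_z$ for all $t\ge 0$. Put $\bar w=w_{\max}/\sigma_w$,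 $\bar\eta=\eta_{\max}/\sigma_\eta$ and $$\mathrm{poly}_1=\max\Big(\frac{\bar w}{\sigma_w},\frac{\bar\eta}{\sigma_\eta},\frac{\bar w\bar\eta}{\sigma_w\sigma_\eta}\Big)\max(\bar w,\bar\eta),\qquad \mathrm{poly}_2=\bar w\,\max(\bar w^2,\bar\eta^2)\,\max(\bar w\sigma_\eta,\bar\eta\sigma_w,\bar w\bar\eta).$$ **Theorem.** There are absolute constants $c_1,c_2>0$ such that, in every such setting, for every $0<\delta<1/3$ and every $T\in\mathbb N$ with $$T\ \ge\ c_1\,(m+n)\max(\bar w^4,\bar\eta^4)\,\log\Big(\frac{b_z}{\delta}\,\mathrm{poly}_1\Big),$$ with probability at least $1-3\delta$ every least-squares estimate $\hat\theta=(\hat A,\hat B)\in\arg\min_{A,B}\sum_{s=1}^T\|x_s-Ax_{s-1}-Bu_{s-1}\|_2^2$ satisfies, in spectral norm, $$\|\hat\theta-\theta_*\|_2\ \le\ c_2\,\frac{b_z\sqrt{m+n}}{\sqrt T\,\sigma_\eta}\,\mathrm{poly}_2\,\sqrt{\log\Big(\frac{b_z}{\delta}\Big)+\log(\mathrm{poly}_1)}.$$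 -/

import Mathlib

open MeasureTheory ProbabilityTheory
open scoped Matrix.Norms.L2Operator

namespace SysId

/-- `ℝᵏ` with the Euclidean norm. -/
abbrev Vec (k : ℕ) := EuclideanSpace ℝ (Fin k)

/-- The covariance matrix of a random vector. -/
noncomputable def covMatrix {Ω : Type*} [MeasurableSpace Ω] (μ : Measure Ω) {k : ℕ}
    (X : Ω → Vec k) : Matrix (Fin k) (Fin k) ℝ :=
  Matrix.of fun i j => cov[fun ω => X ω i, fun ω => X ω j; μ]

/-- `ξ` is an i.i.d. sequence of random vectors with mean zero, with norm at most `r` almost surely,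
and such that every eigenvalue of the covariance matrix is at least `σ ^ 2 > 0`. -/
structure IsBoundedNoise {Ω : Type*} [MeasurableSpace Ω] (μ : Measure Ω) {k : ℕ}
    (ξ : ℕ → Ω → Vec k) (r σ : ℝ) : Prop where
  measurable : ∀ t, Measurable (ξ t)
  indep : iIndepFun ξ μ
  ident : ∀ t, IdentDistrib (ξ t) (ξ 0) μ μ
  mean_zero : ∀ t, ∫ ω, ξ t ω ∂μ = 0
  bounded : ∀ t, ∀ᵐ ω ∂μ, ‖ξ t ω‖ ≤ r
  sigma_pos : 0 < σ
  cov_lower : ∀ t, ∀ c ∈ spectrum ℝ (covMatrix μ (ξ t)), σ ^ 2 ≤ c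

/-- A policy: at time `t` it maps the state `x_t` and the history `(x_s, u_s, η_s)`, `s < t`,
to a nominal control input. -/
abbrev Policy (n m : ℕ) :=
  (t : ℕ) → Vec n × (Fin t → Vec n × Vec m × Vec m) → Vec m

/-- The states `x` and inputs `u` are generated by the system `x_{t+1} = A x_t + B u_t + w_t`
in closed loop with `u_t = π_t(x_t, {x_s, u_s, η_s}_{s < t}) + η_t`. -/
structure IsClosedLoop {Ω : Type*} {n m : ℕ} (A : Matrix (Fin n) (Fin n) ℝ)
    (B : Matrix (Fin n) (Fin m) ℝ) (π : Policy n m) (w : ℕ → Ω → Vec n) (η : ℕ → Ω → Vec m)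
    (x : ℕ → Ω → Vec n) (u : ℕ → Ω → Vec m) : Prop where
  state : ∀ t ω, x (t + 1) ω =
    Matrix.toEuclideanLin A (x t ω) + Matrix.toEuclideanLin B (u t ω) + w t ω
  input : ∀ t ω, u t ω =
    π t (x t ω, fun s : Fin t => (x s ω, u s ω, η s ω)) + η t ω

/-- The least-squares cost `∑_{s=1}^T ‖x_s - A x_{s-1} - B u_{s-1}‖²` along a trajectory. -/
noncomputable def lsCost {n m : ℕ} (T : ℕ) (x : ℕ → Vec n) (u : ℕ → Vec m)
    (A : Matrix (Fin n) (Fin n) ℝ) (B : Matrix (Fin n) (Fin m) ℝ) : ℝ :=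
  ∑ s ∈ Finset.Icc 1 T,
    ‖x s - Matrix.toEuclideanLin A (x (s - 1)) - Matrix.toEuclideanLin B (u (s - 1))‖ ^ 2

/-- `(A, B)` is a least-squares estimate, i.e. a minimizer of the least-squares cost. -/
def IsLSE {n m : ℕ} (T : ℕ) (x : ℕ → Vec n) (u : ℕ → Vec m)
    (A : Matrix (Fin n) (Fin n) ℝ) (B : Matrix (Fin n) (Fin m) ℝ) : Prop :=
  ∀ A' B', lsCost T x u A B ≤ lsCost T x u A' B'

/-- `max(w̄/σ_w, η̄/σ_η, w̄ η̄/(σ_w σ_η)) max(w̄, η̄)`. -/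
noncomputable def poly₁ (wbar ηbar σw ση : ℝ) : ℝ :=
  max (max (wbar / σw) (ηbar / ση)) (wbar * ηbar / (σw * ση)) * max wbar ηbar

/-- `w̄ max(w̄², η̄²) max(w̄ σ_η, η̄ σ_w, w̄ η̄)`. -/
noncomputable def poly₂ (wbar ηbar σw ση : ℝ) : ℝ :=
  wbar * max (wbar ^ 2) (ηbar ^ 2) * max (max (wbar * ση) (ηbar * σw)) (wbar * ηbar)

end SysId

/-! Write z_s = (x_s, u_s), Q(v) = ∑ ⟨v, z_s⟩², d = n + m, and let Λ and L be the argument and the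
value of the logarithm in the condition on T. Row i of the estimation error, e_i, solves the normal
equations ∑ ⟨e_i, z_s⟩⟨y, z_s⟩ = M_i(y) with M_i(y) = ∑ w_{s,i}⟨y, z_s⟩ (`IsLSE.normal_equation`).
Hence a lower bound on Q and an upper bound on M_i suffice, each obtained on a finite net.

Lower bound on Q. The policy is arbitrary, but it cannot cancel fresh noise. Let v = (α, β). If β is
not too small, η_{t+1} moves ⟨v, z_{t+1}⟩ whatever the policy chose. If β is tiny, w_t moves ⟨α,
x_{t+1}⟩, and an input of norm at most `bz` is too weak along β to undo this. So, conditionally on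
the past, each direction is hit at scale σw ση / (6 bz) often enough
(`IsBoundedLoop.lintegral_mul_hitWeight_le`). A Chernoff bound (`measure_hits_le`) and a net of the
unit ball then give Q(v) ≥ l²‖v‖² with l of order √T (`exists_excitation_event`).

Upper bound on M_i. Since w_s is bounded, centered and independent of z_s and the earlier past,
Hoeffding's lemma makes the exponential of M_i minus a multiple of Q a supermartingale
(`measure_martingale_le`). The normalized error y = e_i / √Q(e_i) lies in the ball of radius 1/l,
and a mesh of order 1/(√T bz) suffices there. The ratio of radius to mesh does not depend on T, so
no log T appears. Evaluating the normal equations at a net point near y bounds √Q(e_i)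
(`norm_le_of_normal_equation`).

Both nets have at most exp(O(d L)) points, because Λ dominates every constant of the problem
(`log_argument_bounds`). The passage from rows to the spectral norm costs √n ≤ w̄, which `poly₂`
absorbs. -/

namespace SysId

open scoped ENNReal

/-! ### Independence and integration over a fresh variable -/

section Independence

variable {Ω : Type*} {mΩ : MeasurableSpace Ω} {μ : Measure Ω}

/-- If `a` is independent of `b ⊔ c`, and `b` of `c`, then `a ⊔ b` is independent of `c`. -/
lemma indep_sup_left_of_indep [IsProbabilityMeasure μ] {a b c : MeasurableSpace Ω}
    (ha : a ≤ mΩ) (hb : b ≤ mΩ) (hc : c ≤ mΩ)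
    (h₁ : Indep a (b ⊔ c) μ) (h₂ : Indep b c μ) : Indep (a ⊔ b) c μ := by
  -- The intersections s ∩ t form a π-system generating `a ⊔ b`, so independence need only be
  -- checked on them.
  have hgen : a ⊔ b = MeasurableSpace.generateFrom
      (Set.image2 (· ∩ ·) {s | MeasurableSet[a] s} {s | MeasurableSet[b] s}) := by
    apply le_antisymm
    · refine sup_le ?_ ?_
      · intro s hs
        exact MeasurableSpace.measurableSet_generateFrom
          ⟨s, hs, Set.univ, MeasurableSet.univ, Set.inter_univ s⟩
      · intro s hs
        exact MeasurableSpace.measurableSet_generateFrom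
          ⟨Set.univ, MeasurableSet.univ, s, hs, Set.univ_inter s⟩
    · refine MeasurableSpace.generateFrom_le ?_
      rintro _ ⟨s, hs, t, ht, rfl⟩
      have h1 : MeasurableSet[a ⊔ b] s := (le_sup_left : a ≤ a ⊔ b) s hs
      have h2 : MeasurableSet[a ⊔ b] t := (le_sup_right : b ≤ a ⊔ b) t ht
      exact MeasurableSet.inter h1 h2
  refine IndepSets.indep (sup_le ha hb) hc ?_ (@MeasurableSpace.isPiSystem_measurableSet Ω c) hgen
    (@MeasurableSpace.generateFrom_measurableSet Ω c).symm ?_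
  · rintro _ ⟨s, hs, t, ht, rfl⟩ _ ⟨s', hs', t', ht', rfl⟩ _
    exact ⟨s ∩ s', MeasurableSet.inter hs hs', t ∩ t', MeasurableSet.inter ht ht',
      Set.inter_inter_inter_comm _ _ _ _⟩
  · rw [IndepSets_iff]
    rintro _ q ⟨s, hs, t, ht, rfl⟩ hq
    rw [Indep_iff] at h₁ h₂
    have ht' : MeasurableSet[b ⊔ c] t := (le_sup_left : b ≤ b ⊔ c) t ht
    have hq' : MeasurableSet[b ⊔ c] q := (le_sup_right : c ≤ b ⊔ c) q hq
    change μ ((s ∩ t) ∩ q) = μ (s ∩ t) * μ q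
    rw [Set.inter_assoc, h₁ s (t ∩ q) hs (MeasurableSet.inter ht' hq'), h₂ t q ht hq,
      h₁ s t hs ht', mul_assoc]

/-- Freezing lemma: integrate out an independent real variable under a uniform bound. -/
lemma lintegral_mul_le_of_indepFun [IsProbabilityMeasure μ] {Y : Ω → ℝ≥0∞} {c X : Ω → ℝ}
    (hY : Measurable Y) (hc : Measurable c) (hX : Measurable X)
    (hind : IndepFun (fun ω => (Y ω, c ω)) X μ) {g : ℝ × ℝ → ℝ≥0∞} (hg : Measurable g)
    {C : ℝ≥0∞} (hC : ∀ a, ∫⁻ ω, g (a, X ω) ∂μ ≤ C) :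
    ∫⁻ ω, Y ω * g (c ω, X ω) ∂μ ≤ C * ∫⁻ ω, Y ω ∂μ := by
  have hYc : Measurable (fun ω => (Y ω, c ω)) := hY.prodMk hc
  have hmap := (indepFun_iff_map_prod_eq_prod_map_map hYc.aemeasurable hX.aemeasurable).1 hind
  have hF : Measurable (fun q : (ℝ≥0∞ × ℝ) × ℝ => q.1.1 * g (q.1.2, q.2)) := by fun_prop
  calc ∫⁻ ω, Y ω * g (c ω, X ω) ∂μ
      = ∫⁻ q, q.1.1 * g (q.1.2, q.2) ∂(μ.map fun ω => ((Y ω, c ω), X ω)) := by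
        rw [lintegral_map hF (hYc.prodMk hX)]
    _ = ∫⁻ h, ∫⁻ x, h.1 * g (h.2, x) ∂(μ.map X) ∂(μ.map fun ω => (Y ω, c ω)) := by
        have : IsProbabilityMeasure (μ.map X) := Measure.isProbabilityMeasure_map hX.aemeasurable
        rw [hmap, lintegral_prod _ hF.aemeasurable]
    _ ≤ ∫⁻ h, C * h.1 ∂(μ.map fun ω => (Y ω, c ω)) := by
        refine lintegral_mono fun h => ?_
        rw [lintegral_const_mul _ (by fun_prop), lintegral_map (by fun_prop) hX, mul_comm]
        gcongr
        exact hC h.2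
    _ = C * ∫⁻ ω, Y ω ∂μ := by
        rw [lintegral_map (by fun_prop) hYc, lintegral_const_mul _ hY]

end Independence

/-! ### One-dimensional anti-concentration and Hoeffding's lemma -/

section SmallBall

variable {Ω : Type*} [MeasurableSpace Ω] {μ : Measure Ω} [IsProbabilityMeasure μ]

/-- `exp (-1)` if `|a| ≥ θ`, and `1` otherwise. -/
noncomputable def hitWeight (θ a : ℝ) : ℝ := Real.exp (-(if θ ≤ |a| then 1 else 0))

lemma measurable_hitWeight (θ : ℝ) : Measurable (hitWeight θ) := by
  unfold hitWeight
  refine Real.measurable_exp.comp (Measurable.neg ?_)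
  exact Measurable.ite (measurableSet_le measurable_const (by fun_prop)) measurable_const
    measurable_const

lemma hitWeight_pos (θ a : ℝ) : 0 < hitWeight θ a := Real.exp_pos _

lemma hitWeight_le_one (θ a : ℝ) : hitWeight θ a ≤ 1 := by
  unfold hitWeight
  split_ifs <;> simp

/-- Transfers the estimate from a noise-driven variable to the regressor: more hits mean less
weight. -/
lemma hitWeight_le_of_abs_le {θ θ' a b : ℝ} (h : θ' ≤ |b| → θ ≤ |a|) :
    hitWeight θ a ≤ hitWeight θ' b := by
  unfold hitWeight
  split_ifs with h1 h2 h2 <;> simp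
  exact absurd (h h2) h1

lemma exp_neg_one_le_half : Real.exp (-1) ≤ 1 / 2 := by
  rw [Real.exp_neg, one_div]
  have := Real.add_one_le_exp (1 : ℝ)
  gcongr
  linarith

/-- Bounded centered variables with large variance are anti-concentrated, uniformly in shifts. -/
lemma integral_hitWeight_le {X : Ω → ℝ} {M s p : ℝ} (hX : Measurable X)
    (hM : 0 < M) (hb : ∀ᵐ ω ∂μ, |X ω| ≤ M) (h0 : ∫ ω, X ω ∂μ = 0)
    (hs0 : 0 ≤ s) (hs : s ^ 2 ≤ ∫ ω, X ω ^ 2 ∂μ) (hp : p ≤ s ^ 2 / (18 * M ^ 2)) (a : ℝ) :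
    ∫ ω, hitWeight (2 / 3 * s) (a + X ω) ∂μ ≤ Real.exp (-(p / 2)) := by
  have hint : Integrable X μ :=
    Integrable.of_bound hX.aestronglyMeasurable M (by simpa [Real.norm_eq_abs] using hb)
  have hint2 : Integrable (fun ω => X ω ^ 2) μ := by
    refine Integrable.of_bound (hX.pow_const 2).aestronglyMeasurable (M ^ 2) ?_
    filter_upwards [hb] with ω h
    rw [Real.norm_eq_abs, abs_pow]
    gcongr
  have hsM : s ^ 2 ≤ M ^ 2 := by
    refine hs.trans ?_
    calc ∫ ω, X ω ^ 2 ∂μ ≤ ∫ _, M ^ 2 ∂μ := by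
          refine integral_mono_ae hint2 (integrable_const _) ?_
          filter_upwards [hb] with ω h
          exact sq_le_sq' (abs_le.1 h).1 (abs_le.1 h).2
      _ = M ^ 2 := by simp
  have hsM' : s ≤ M := by nlinarith
  have hintw : Integrable (fun ω => hitWeight (2 / 3 * s) (a + X ω)) μ := by
    refine Integrable.of_bound
      ((measurable_hitWeight _).comp (hX.const_add a)).aestronglyMeasurable 1 (.of_forall fun ω => ?_)
    rw [Real.norm_eq_abs, abs_of_pos (hitWeight_pos _ _)]
    exact hitWeight_le_one _ _
  have key : ∫ ω, hitWeight (2 / 3 * s) (a + X ω) ∂μ ≤ 1 - p / 2 := by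
    have hM2 : 0 < 18 * M ^ 2 := by positivity
    -- For moderate shifts |a + X| ≤ 3M, so the parabola 1 - ((a + X)² - (2s/3)²) / (18M²) dominates
    -- the weight: it is at least 1/2 on hits and at least 1 on misses. Its mean is controlled by
    -- the second moment. For larger shifts |a + X| ≥ M ≥ s, so every outcome is a hit.
    by_cases ha : |a| ≤ 2 * M
    · calc ∫ ω, hitWeight (2 / 3 * s) (a + X ω) ∂μ
          ≤ ∫ ω, (1 + (4 / 9 * s ^ 2 - a ^ 2) / (18 * M ^ 2) - 2 * a / (18 * M ^ 2) * X ω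
              - 1 / (18 * M ^ 2) * X ω ^ 2) ∂μ := by
            refine integral_mono_ae hintw (((integrable_const _).sub (hint.const_mul _)).sub
              (hint2.const_mul _)) ?_
            filter_upwards [hb] with ω h
            have e : 1 + (4 / 9 * s ^ 2 - a ^ 2) / (18 * M ^ 2) - 2 * a / (18 * M ^ 2) * X ω
              - 1 / (18 * M ^ 2) * X ω ^ 2
                = 1 - ((a + X ω) ^ 2 - (2 / 3 * s) ^ 2) / (18 * M ^ 2) := by
              field_simp; ring
            rw [e]
            unfold hitWeight
            have h3 : |a + X ω| ≤ 3 * M := (abs_add_le _ _).trans (by linarith)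
            have h4 : (a + X ω) ^ 2 ≤ 9 * M ^ 2 := by
              rw [← sq_abs]
              nlinarith [abs_nonneg (a + X ω)]
            split_ifs with h5
            · have : ((a + X ω) ^ 2 - (2 / 3 * s) ^ 2) / (18 * M ^ 2) ≤ 1 / 2 := by
                rw [div_le_iff₀ hM2]
                nlinarith [sq_nonneg (2 / 3 * s)]
              linarith [exp_neg_one_le_half]
            · have : ((a + X ω) ^ 2 - (2 / 3 * s) ^ 2) / (18 * M ^ 2) ≤ 0 := by
                refine div_nonpos_of_nonpos_of_nonneg ?_ hM2.le
                rw [← sq_abs (a + X ω)]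
                nlinarith [abs_nonneg (a + X ω)]
              simp only [neg_zero, Real.exp_zero]
              linarith
        _ = 1 + (4 / 9 * s ^ 2 - a ^ 2) / (18 * M ^ 2)
              - 1 / (18 * M ^ 2) * ∫ ω, X ω ^ 2 ∂μ := by
            have i1 : Integrable (fun _ : Ω => 1 + (4 / 9 * s ^ 2 - a ^ 2) / (18 * M ^ 2)) μ :=
              integrable_const _
            have i2 : Integrable (fun ω => 2 * a / (18 * M ^ 2) * X ω) μ := hint.const_mul _
            have i3 : Integrable (fun ω => 1 / (18 * M ^ 2) * X ω ^ 2) μ := hint2.const_mul _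
            have i4 : Integrable (fun ω => 1 + (4 / 9 * s ^ 2 - a ^ 2) / (18 * M ^ 2)
              - 2 * a / (18 * M ^ 2) * X ω) μ := i1.sub i2
            rw [integral_sub i4 i3, integral_sub i1 i2, integral_const_mul,
              integral_const_mul, h0]
            simp
        _ ≤ 1 + (4 / 9 * s ^ 2 - a ^ 2) / (18 * M ^ 2) - 1 / (18 * M ^ 2) * s ^ 2 := by
            gcongr
        _ = 1 - (5 / 9) * (s ^ 2 / (18 * M ^ 2)) - a ^ 2 / (18 * M ^ 2) := by ring
        _ ≤ 1 - p / 2 := by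
            have h6 : 0 ≤ a ^ 2 / (18 * M ^ 2) := by positivity
            have h7 : 0 ≤ s ^ 2 / (18 * M ^ 2) := by positivity
            linarith
    · push Not at ha
      have hp' : p ≤ 1 := by
        refine hp.trans ?_
        rw [div_le_one hM2]
        nlinarith
      calc ∫ ω, hitWeight (2 / 3 * s) (a + X ω) ∂μ ≤ ∫ _, (1 / 2 : ℝ) ∂μ := by
            refine integral_mono_ae hintw (integrable_const _) ?_
            filter_upwards [hb] with ω h
            have h1 : 2 / 3 * s ≤ |a + X ω| := by
              have := abs_sub_abs_le_abs_add a (X ω)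
              linarith
            simp only [hitWeight, if_pos h1]
            exact exp_neg_one_le_half
        _ = 1 / 2 := by simp
        _ ≤ 1 - p / 2 := by linarith
  have := Real.add_one_le_exp (-(p / 2))
  linarith

lemma lintegral_hitWeight_le {X : Ω → ℝ} {M s p : ℝ} (hX : Measurable X)
    (hM : 0 < M) (hb : ∀ᵐ ω ∂μ, |X ω| ≤ M) (h0 : ∫ ω, X ω ∂μ = 0)
    (hs0 : 0 ≤ s) (hs : s ^ 2 ≤ ∫ ω, X ω ^ 2 ∂μ) (hp : p ≤ s ^ 2 / (18 * M ^ 2)) (a : ℝ) :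
    ∫⁻ ω, ENNReal.ofReal (hitWeight (2 / 3 * s) (a + X ω)) ∂μ
      ≤ ENNReal.ofReal (Real.exp (-(p / 2))) := by
  rw [← ofReal_integral_eq_lintegral_ofReal]
  · exact ENNReal.ofReal_le_ofReal (integral_hitWeight_le hX hM hb h0 hs0 hs hp a)
  · refine Integrable.of_bound
      ((measurable_hitWeight _).comp (hX.const_add a)).aestronglyMeasurable 1 (.of_forall fun ω => ?_)
    rw [Real.norm_eq_abs, abs_of_pos (hitWeight_pos _ _)]
    exact hitWeight_le_one _ _
  · exact .of_forall fun ω => (hitWeight_pos _ _).le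

/-- Hoeffding's lemma in exponential supermartingale form. -/
lemma lintegral_exp_mul_sub_le_one {X : Ω → ℝ} {M : ℝ} (hX : Measurable X)
    (hb : ∀ᵐ ω ∂μ, |X ω| ≤ M) (h0 : ∫ ω, X ω ∂μ = 0) (a : ℝ) :
    ∫⁻ ω, ENNReal.ofReal (Real.exp (a * X ω - a ^ 2 * M ^ 2 / 2)) ∂μ ≤ 1 := by
  have hsub := hasSubgaussianMGF_of_mem_Icc_of_integral_eq_zero (a := -M) (b := M)
    hX.aemeasurable (by filter_upwards [hb] with ω h using abs_le.1 h) h0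
  have hint := hsub.integrable_exp_mul a
  have hle := hsub.mgf_le a
  have e : ∀ ω, Real.exp (a * X ω - a ^ 2 * M ^ 2 / 2)
      = Real.exp (-(a ^ 2 * M ^ 2 / 2)) * Real.exp (a * X ω) := fun ω => by
    rw [← Real.exp_add]; ring_nf
  simp_rw [e]
  rw [← ofReal_integral_eq_lintegral_ofReal (hint.const_mul _)
    (.of_forall fun ω => by positivity), ← ENNReal.ofReal_one, integral_const_mul]
  refine ENNReal.ofReal_le_ofReal ?_
  have hle' : ∫ ω, Real.exp (a * X ω) ∂μ ≤ Real.exp (a ^ 2 * M ^ 2 / 2) := by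
    refine hle.trans (le_of_eq ?_)
    congr 1
    have : ((‖M - -M‖₊ / 2 : NNReal) : ℝ) ^ 2 = M ^ 2 := by
      have : M - -M = 2 * M := by ring
      rw [this]
      simp
    push_cast at this ⊢
    rw [this]; ring
  calc _ ≤ Real.exp (-(a ^ 2 * M ^ 2 / 2)) * Real.exp (a ^ 2 * M ^ 2 / 2) := by gcongr
    _ = 1 := by rw [← Real.exp_add]; simp

end SmallBall

/-! ### Moments of the noise vectors -/

section Noise

variable {Ω : Type*} [MeasurableSpace Ω] {μ : Measure Ω} {k : ℕ}
  {ξ : ℕ → Ω → Vec k} {r σ : ℝ}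

/-- The quadratic form of a symmetric matrix is bounded below by any lower spectral bound. -/
lemma le_dotProduct_mulVec_of_spectrum {C : Matrix (Fin k) (Fin k) ℝ} (hC : C.IsHermitian) {b : ℝ}
    (h : ∀ c ∈ spectrum ℝ C, b ≤ c) (v : Vec k) : b * ‖v‖ ^ 2 ≤ v.ofLp ⬝ᵥ C.mulVec v.ofLp := by
  have hH : (C - b • (1 : Matrix (Fin k) (Fin k) ℝ)).IsHermitian := by
    refine hC.sub ?_
    rw [Matrix.IsHermitian, Matrix.conjTranspose_smul, Matrix.conjTranspose_one]; rfl
  have hpsd : (C - b • (1 : Matrix (Fin k) (Fin k) ℝ)).PosSemidef := by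
    rw [hH.posSemidef_iff_eigenvalues_nonneg]
    have hshift : ∀ c ∈ spectrum ℝ (C - b • (1 : Matrix (Fin k) (Fin k) ℝ)), c + b ∈ spectrum ℝ C := by
      intro c hc
      rw [spectrum.mem_iff] at hc ⊢
      convert hc using 2
      rw [← Algebra.algebraMap_eq_smul_one, map_add]; abel
    intro i
    simpa using h _ (hshift _ (hH.eigenvalues_mem_spectrum_real i))
  have := hpsd.dotProduct_mulVec_nonneg v.ofLp
  rw [Matrix.sub_mulVec, dotProduct_sub, Matrix.smul_mulVec, Matrix.one_mulVec,
    dotProduct_smul] at this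
  have e : v.ofLp ⬝ᵥ v.ofLp = ‖v‖ ^ 2 := by
    rw [EuclideanSpace.norm_sq_eq]; simp [dotProduct, sq]
  simp only [star_trivial, smul_eq_mul, e] at this
  linarith

lemma IsBoundedNoise.measurable_inner (h : IsBoundedNoise μ ξ r σ) (t : ℕ) (v : Vec k) :
    Measurable fun ω => inner ℝ v (ξ t ω) :=
  (measurable_const (a := v)).inner (h.measurable t)

lemma IsBoundedNoise.abs_inner_le (h : IsBoundedNoise μ ξ r σ) (t : ℕ) (v : Vec k) :
    ∀ᵐ ω ∂μ, |inner ℝ v (ξ t ω)| ≤ ‖v‖ * r := by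
  filter_upwards [h.bounded t] with ω hω
  exact (abs_real_inner_le_norm _ _).trans (by gcongr)

lemma IsBoundedNoise.nonneg [IsProbabilityMeasure μ] (h : IsBoundedNoise μ ξ r σ) : 0 ≤ r := by
  obtain ⟨ω, hω⟩ := (h.bounded 0).exists
  exact (norm_nonneg _).trans hω

lemma IsBoundedNoise.integrable [IsProbabilityMeasure μ] (h : IsBoundedNoise μ ξ r σ) (t : ℕ) : Integrable (ξ t) μ :=
  Integrable.of_bound (h.measurable t).aestronglyMeasurable r (h.bounded t)

lemma IsBoundedNoise.integral_inner_eq_zero [IsProbabilityMeasure μ] (h : IsBoundedNoise μ ξ r σ) (t : ℕ) (v : Vec k) :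
    ∫ ω, inner ℝ v (ξ t ω) ∂μ = 0 := by
  rw [_root_.integral_inner (h.integrable t), h.mean_zero t, inner_zero_right]

lemma IsBoundedNoise.memLp_apply [IsProbabilityMeasure μ] (h : IsBoundedNoise μ ξ r σ) (t : ℕ) (i : Fin k) :
    MemLp (fun ω => ξ t ω i) 2 μ := by
  refine MemLp.of_bound ?_ r ?_
  · exact Measurable.aestronglyMeasurable (by have := h.measurable t; fun_prop)
  · filter_upwards [h.bounded t] with ω hω
    exact (PiLp.norm_apply_le _ i).trans hω

/-- The mean vanishes, so the second moment along v is the variance, i.e. the quadratic form of the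
covariance matrix at v. -/
lemma IsBoundedNoise.le_integral_inner_sq [IsProbabilityMeasure μ] (h : IsBoundedNoise μ ξ r σ) (t : ℕ) (v : Vec k) :
    (‖v‖ * σ) ^ 2 ≤ ∫ ω, inner ℝ v (ξ t ω) ^ 2 ∂μ := by
  have hsymm : (covMatrix μ (ξ t)).IsHermitian := by
    ext i j
    simp [covMatrix, covariance_comm]
  have h1 := le_dotProduct_mulVec_of_spectrum hsymm (h.cov_lower t) v
  have h2 : v.ofLp ⬝ᵥ (covMatrix μ (ξ t)).mulVec v.ofLp = Var[fun ω => inner ℝ v (ξ t ω); μ] := by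
    have e : (fun ω => inner ℝ v (ξ t ω)) = fun ω => ∑ i, v i * ξ t ω i := by
      ext ω
      simp [PiLp.inner_apply, mul_comm]
    rw [← covariance_self (h.measurable_inner t v).aemeasurable, e,
      covariance_fun_sum_fun_sum (fun i => (h.memLp_apply t i).const_mul _)
        (fun i => (h.memLp_apply t i).const_mul _)]
    simp only [covariance_const_mul_left, covariance_const_mul_right, dotProduct, Matrix.mulVec,
      Finset.mul_sum, covMatrix, Matrix.of_apply]
    refine Finset.sum_congr rfl fun i _ => Finset.sum_congr rfl fun j _ => by ring
  rw [h2, variance_of_integral_eq_zero (h.measurable_inner t v).aemeasurable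
    (h.integral_inner_eq_zero t v)] at h1
  calc _ = σ ^ 2 * ‖v‖ ^ 2 := by ring
    _ ≤ _ := h1

/-- Compares the trace of the covariance with E‖ξ‖². It bounds the dimensions by n ≤ w̄² and m ≤
η̄², which lets the logarithm absorb dimension factors. -/
lemma IsBoundedNoise.card_mul_sq_le [IsProbabilityMeasure μ] (h : IsBoundedNoise μ ξ r σ) : k * σ ^ 2 ≤ r ^ 2 := by
  have h1 : ∀ i : Fin k, σ ^ 2 ≤ ∫ ω, ξ 0 ω i ^ 2 ∂μ := fun i => by
    have := h.le_integral_inner_sq 0 (EuclideanSpace.single i (1 : ℝ))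
    simpa [EuclideanSpace.inner_single_left] using this
  have hint : ∀ i : Fin k, Integrable (fun ω => ξ 0 ω i ^ 2) μ := fun i =>
    (h.memLp_apply 0 i).integrable_sq
  calc (k : ℝ) * σ ^ 2 = ∑ _i : Fin k, σ ^ 2 := by simp
    _ ≤ ∑ i : Fin k, ∫ ω, ξ 0 ω i ^ 2 ∂μ := Finset.sum_le_sum fun i _ => h1 i
    _ = ∫ ω, ∑ i : Fin k, ξ 0 ω i ^ 2 ∂μ := (integral_finsetSum _ fun i _ => hint i).symm
    _ ≤ ∫ _, r ^ 2 ∂μ := by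
        refine integral_mono_ae (integrable_finsetSum _ fun i _ => hint i) (integrable_const _) ?_
        filter_upwards [h.bounded 0] with ω hω
        have e : ∑ i : Fin k, ξ 0 ω i ^ 2 = ‖ξ 0 ω‖ ^ 2 := by
          rw [EuclideanSpace.norm_sq_eq]; simp
        simp only [e]
        gcongr
    _ = r ^ 2 := by simp

end Noise

/-! ### The filtration and adaptedness of the closed loop -/

section History

variable {Ω : Type*} {mΩ : MeasurableSpace Ω} {n m : ℕ}

/-- The information in the initial state, the first `a` process noises and the first `b` input
noises. -/
abbrev hist (x₀ : Ω → Vec n) (w : ℕ → Ω → Vec n) (η : ℕ → Ω → Vec m) (a b : ℕ) : MeasurableSpace Ω :=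
  MeasurableSpace.comap x₀ inferInstance ⊔
    ((⨆ s ∈ Set.Iio a, MeasurableSpace.comap (w s) inferInstance) ⊔
      (⨆ s ∈ Set.Iio b, MeasurableSpace.comap (η s) inferInstance))

variable {x₀ : Ω → Vec n} {w : ℕ → Ω → Vec n} {η : ℕ → Ω → Vec m}

lemma hist_mono {a a' b b' : ℕ} (ha : a ≤ a') (hb : b ≤ b') :
    hist x₀ w η a b ≤ hist x₀ w η a' b' := by
  unfold hist
  refine sup_le_sup le_rfl (sup_le_sup ?_ ?_)
  · exact biSup_mono fun s hs => lt_of_lt_of_le hs ha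
  · exact biSup_mono fun s hs => lt_of_lt_of_le hs hb

lemma comap_biSup_le {k : ℕ} {ξ : ℕ → Ω → Vec k} (hξ : ∀ t, Measurable (ξ t)) (S : Set ℕ) :
    ⨆ s ∈ S, MeasurableSpace.comap (ξ s) inferInstance ≤ mΩ :=
  iSup₂_le fun s _ => (hξ s).comap_le

lemma hist_le (hx : Measurable x₀) (hw : ∀ t, Measurable (w t)) (hη : ∀ t, Measurable (η t))
    (a b : ℕ) : hist x₀ w η a b ≤ mΩ :=
  sup_le hx.comap_le (sup_le (comap_biSup_le hw _) (comap_biSup_le hη _))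

lemma measurable_hist_init (a b : ℕ) : Measurable[hist x₀ w η a b] x₀ :=
  Measurable.mono (comap_measurable x₀) le_sup_left le_rfl

lemma measurable_hist_left {a b s : ℕ} (hs : s < a) : Measurable[hist x₀ w η a b] (w s) := by
  refine Measurable.mono (comap_measurable (w s)) ?_ le_rfl
  exact (le_biSup (fun s => MeasurableSpace.comap (w s) inferInstance) (Set.mem_Iio.2 hs)).trans
    (le_sup_left.trans le_sup_right)

lemma measurable_hist_right {a b s : ℕ} (hs : s < b) : Measurable[hist x₀ w η a b] (η s) := by
  refine Measurable.mono (comap_measurable (η s)) ?_ le_rfl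
  exact (le_biSup (fun s => MeasurableSpace.comap (η s) inferInstance) (Set.mem_Iio.2 hs)).trans
    (le_sup_right.trans le_sup_right)

lemma comap_biSup_le_comap_pi {k : ℕ} (ξ : ℕ → Ω → Vec k) (S : Set ℕ) :
    ⨆ s ∈ S, MeasurableSpace.comap (ξ s) inferInstance ≤
      MeasurableSpace.comap (fun ω t => ξ t ω) inferInstance := by
  refine iSup₂_le fun s _ => ?_
  have : ξ s = (fun f : ℕ → Vec k => f s) ∘ fun ω t => ξ t ω := rfl
  rw [this, ← MeasurableSpace.comap_comp]
  exact MeasurableSpace.comap_mono (measurable_pi_apply s).comap_le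

lemma comap_le_comap_pi {k : ℕ} (ξ : ℕ → Ω → Vec k) (s : ℕ) :
    MeasurableSpace.comap (ξ s) inferInstance ≤
      MeasurableSpace.comap (fun ω t => ξ t ω) inferInstance := by
  simpa using comap_biSup_le_comap_pi ξ {s}

lemma indep_biSup_Iio {μ : Measure Ω} {k : ℕ} {ξ : ℕ → Ω → Vec k} (hξ : ∀ t, Measurable (ξ t))
    (h : iIndepFun ξ μ) (a : ℕ) :
    Indep (⨆ s ∈ Set.Iio a, MeasurableSpace.comap (ξ s) inferInstance)
      (MeasurableSpace.comap (ξ a) inferInstance) μ := by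
  have := indep_iSup_of_disjoint (fun t => (hξ t).comap_le) h
    (S := Set.Iio a) (T := {a}) (by simp)
  simpa using this

variable {μ : Measure Ω}

/-- The sources are peeled off one at a time: the initial state, then the other noise sequence, then
the earlier terms of the same sequence. Two separate indices are needed because η_t enters before
w_t. -/
lemma indep_hist [IsProbabilityMeasure μ] (hx : Measurable x₀) (hw : ∀ t, Measurable (w t)) (hη : ∀ t, Measurable (η t))
    (iw : iIndepFun w μ) (iη : iIndepFun η μ)
    (hwη : IndepFun (fun ω t => w t ω) (fun ω t => η t ω) μ)
    (hx₀ : IndepFun x₀ (fun ω => ((fun t => w t ω), (fun t => η t ω))) μ) (a b : ℕ) :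
    Indep (hist x₀ w η a b) (MeasurableSpace.comap (w a) inferInstance) μ ∧
      Indep (hist x₀ w η a b) (MeasurableSpace.comap (η b) inferInstance) μ := by
  rw [IndepFun_iff_Indep] at hwη hx₀
  have hWle := comap_biSup_le hw (Set.Iio a)
  have hNle := comap_biSup_le hη (Set.Iio b)
  have hW := comap_biSup_le_comap_pi w (Set.Iio a)
  have hN := comap_biSup_le_comap_pi η (Set.Iio b)
  have hpair : MeasurableSpace.comap (fun ω t => w t ω) inferInstance ⊔
      MeasurableSpace.comap (fun ω t => η t ω) inferInstance ≤
      MeasurableSpace.comap (fun ω => ((fun t => w t ω), (fun t => η t ω))) inferInstance :=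
    (MeasurableSpace.comap_prodMk _ _).ge
  have hpw := (le_sup_left.trans hpair)
  have hpη := (le_sup_right.trans hpair)
  unfold hist
  constructor
  · refine indep_sup_left_of_indep hx.comap_le (sup_le hWle hNle) (hw a).comap_le
      (indep_of_indep_of_le_right hx₀ (sup_le (sup_le (hW.trans hpw) (hN.trans hpη))
        ((comap_le_comap_pi w a).trans hpw))) ?_
    rw [sup_comm]
    refine indep_sup_left_of_indep hNle hWle (hw a).comap_le ?_ (indep_biSup_Iio hw iw a)
    exact indep_of_indep_of_le_left (indep_of_indep_of_le_right hwη.symm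
      (sup_le hW (comap_le_comap_pi w a))) hN
  · refine indep_sup_left_of_indep hx.comap_le (sup_le hWle hNle) (hη b).comap_le
      (indep_of_indep_of_le_right hx₀ (sup_le (sup_le (hW.trans hpw) (hN.trans hpη))
        ((comap_le_comap_pi η b).trans hpη))) ?_
    refine indep_sup_left_of_indep hWle hNle (hη b).comap_le ?_ (indep_biSup_Iio hη iη b)
    exact indep_of_indep_of_le_left (indep_of_indep_of_le_right hwη
      (sup_le hN (comap_le_comap_pi η b))) hW

/-- A pair measurable with respect to `F` is independent of a function of a variable independent
of `F`. -/
lemma indepFun_pair_inner {F : MeasurableSpace Ω} {k : ℕ} {ξ : Ω → Vec k}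
    (h : Indep F (MeasurableSpace.comap ξ inferInstance) μ) {Y : Ω → ℝ≥0∞} {c : Ω → ℝ}
    (hY : Measurable[F] Y) (hc : Measurable[F] c) (v : Vec k) :
    IndepFun (fun ω => (Y ω, c ω)) (fun ω => inner ℝ v (ξ ω)) μ := by
  rw [IndepFun_iff_Indep]
  refine indep_of_indep_of_le_left (indep_of_indep_of_le_right h ?_) ?_
  · have : (fun ω => inner ℝ v (ξ ω)) = (fun z : Vec k => inner ℝ v z) ∘ ξ := rfl
    rw [this, ← MeasurableSpace.comap_comp]
    exact MeasurableSpace.comap_mono (Measurable.comap_le (by fun_prop))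
  · exact (Measurable.prodMk hY hc).comap_le

variable {A : Matrix (Fin n) (Fin n) ℝ} {B : Matrix (Fin n) (Fin m) ℝ} {π : Policy n m}
  {x : ℕ → Ω → Vec n} {u : ℕ → Ω → Vec m}

/-- x_t uses noises with index below t only, whereas u_t also uses η_t; hence the index t + 1. The
induction is strong because the policy sees the whole past. -/
lemma IsClosedLoop.measurable_hist (h : IsClosedLoop A B π w η x u) (hπ : ∀ t, Measurable (π t))
    (t : ℕ) : Measurable[hist (x 0) w η t t] (x t) ∧
      Measurable[hist (x 0) w η t t]
        (fun ω => π t (x t ω, fun s : Fin t => (x s ω, u s ω, η s ω))) ∧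
      Measurable[hist (x 0) w η t (t + 1)] (u t) := by
  induction t using Nat.strong_induction_on with
  | _ t ih =>
    have hx : Measurable[hist (x 0) w η t t] (x t) := by
      rcases t with _ | t
      · exact measurable_hist_init _ _
      · have e : x (t + 1) = fun ω => Matrix.toEuclideanLin A (x t ω)
            + Matrix.toEuclideanLin B (u t ω) + w t ω := funext (h.state t)
        rw [e]
        obtain ⟨h1, -, h3⟩ := ih t (Nat.lt_succ_self t)
        have h1' := h1.mono (hist_mono (a' := t + 1) (b' := t + 1) (by lia) (by lia)) le_rfl
        have h3' := h3.mono (hist_mono (a' := t + 1) (b' := t + 1) (by lia) (by lia)) le_rfl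
        have h4 : Measurable[hist (x 0) w η (t + 1) (t + 1)] (w t) :=
          measurable_hist_left (Nat.lt_succ_self t)
        have hA : Measurable (Matrix.toEuclideanLin A) :=
          (LinearMap.continuous_of_finiteDimensional _).measurable
        have hB : Measurable (Matrix.toEuclideanLin B) :=
          (LinearMap.continuous_of_finiteDimensional _).measurable
        exact ((hA.comp h1').add (hB.comp h3')).add h4
    have hp : Measurable[hist (x 0) w η t t]
        (fun ω => π t (x t ω, fun s : Fin t => (x s ω, u s ω, η s ω))) := by
      refine (hπ t).comp (Measurable.prodMk hx ?_)
      refine @measurable_pi_lambda _ _ _ (hist (x 0) w η t t) _ _ fun s => ?_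
      obtain ⟨h1, -, h3⟩ := ih s s.2
      have hs := s.2
      have h1' : Measurable[hist (x 0) w η t t] (x s) :=
        h1.mono (hist_mono (by lia) (by lia)) le_rfl
      have h3' : Measurable[hist (x 0) w η t t] (u s) :=
        h3.mono (hist_mono (by lia) (by lia)) le_rfl
      have h4' : Measurable[hist (x 0) w η t t] (η s) := measurable_hist_right s.2
      exact h1'.prodMk (h3'.prodMk h4')
    refine ⟨hx, hp, ?_⟩
    have e : u t = fun ω => π t (x t ω, fun s : Fin t => (x s ω, u s ω, η s ω)) + η t ω :=
      funext (h.input t)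
    rw [e]
    exact (hp.mono (hist_mono (by lia) (by lia)) le_rfl).add
      (measurable_hist_right (Nat.lt_succ_self t))

end History

/-! ### The joint state-input vector -/

section Regressor

variable {n m : ℕ}

/-- `ℝⁿ × ℝᵐ` with the Euclidean norm. -/
abbrev Joint (n m : ℕ) := EuclideanSpace ℝ (Fin n ⊕ Fin m)

/-- The regressor `(a, b)`. -/
noncomputable def joinVec (a : Vec n) (b : Vec m) : Joint n m :=
  WithLp.toLp 2 (Sum.elim a.ofLp b.ofLp)

/-- The state component. -/
noncomputable def statePart (v : Joint n m) : Vec n := WithLp.toLp 2 fun i => v (Sum.inl i)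

/-- The input component. -/
noncomputable def inputPart (v : Joint n m) : Vec m := WithLp.toLp 2 fun j => v (Sum.inr j)

lemma inner_joinVec (v : Joint n m) (a : Vec n) (b : Vec m) :
    inner ℝ v (joinVec a b) = inner ℝ (statePart v) a + inner ℝ (inputPart v) b := by
  simp [PiLp.inner_apply, joinVec, statePart, inputPart]

lemma norm_joinVec (a : Vec n) (b : Vec m) : ‖joinVec a b‖ = √(‖a‖ ^ 2 + ‖b‖ ^ 2) := by
  rw [EuclideanSpace.norm_eq, EuclideanSpace.norm_sq_eq, EuclideanSpace.norm_sq_eq]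
  simp [joinVec]

lemma norm_sq_parts (v : Joint n m) : ‖v‖ ^ 2 = ‖statePart v‖ ^ 2 + ‖inputPart v‖ ^ 2 := by
  simp_rw [EuclideanSpace.norm_sq_eq]
  simp [statePart, inputPart]

end Regressor

/-! ### Conditional anti-concentration from one fresh noise vector -/

section NoiseStep

variable {Ω : Type*} {F mΩ : MeasurableSpace Ω} {μ : Measure Ω} [IsProbabilityMeasure μ] {k : ℕ}
  {ξ : ℕ → Ω → Vec k} {r σ : ℝ}

lemma IsBoundedNoise.pos (h : IsBoundedNoise μ ξ r σ) (hk : 1 ≤ k) : 0 < r := by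
  have h1 := h.card_mul_sq_le
  have h2 : (1 : ℝ) ≤ k := by exact_mod_cast hk
  have h3 := h.sigma_pos
  have : 0 < r ^ 2 := lt_of_lt_of_le (by positivity) h1
  exact lt_of_le_of_ne h.nonneg fun h0 => by simp [← h0] at this

/-- Conditionally on `F`, the known part c is merely a shift, and the scalar estimate is uniform in
shifts. -/
lemma IsBoundedNoise.lintegral_mul_hitWeight_le (h : IsBoundedNoise μ ξ r σ) (hr : 0 < r) {t : ℕ}
    (hF : F ≤ mΩ)
    (hind : Indep F (MeasurableSpace.comap (ξ t) inferInstance) μ)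
    {Y : Ω → ℝ≥0∞} {c : Ω → ℝ} (hY : Measurable[F] Y) (hc : Measurable[F] c)
    {v : Vec k} (hv : 0 < ‖v‖) {p : ℝ} (hp : p ≤ σ ^ 2 / (18 * r ^ 2)) :
    ∫⁻ ω, Y ω * ENNReal.ofReal (hitWeight (2 / 3 * (‖v‖ * σ)) (c ω + inner ℝ v (ξ t ω))) ∂μ
      ≤ ENNReal.ofReal (Real.exp (-(p / 2))) * ∫⁻ ω, Y ω ∂μ := by
  refine lintegral_mul_le_of_indepFun (hY.mono hF le_rfl) (hc.mono hF le_rfl)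
    (h.measurable_inner t v) (indepFun_pair_inner hind hY hc v)
    (g := fun q => ENNReal.ofReal (hitWeight (2 / 3 * (‖v‖ * σ)) (q.1 + q.2))) ?_ ?_
  · exact ((measurable_hitWeight _).comp (by fun_prop)).ennreal_ofReal
  · intro a
    refine lintegral_hitWeight_le (h.measurable_inner t v) (by positivity)
      (h.abs_inner_le t v) (h.integral_inner_eq_zero t v) ?_ (h.le_integral_inner_sq t v) ?_ a
    · have := h.sigma_pos
      positivity
    · refine hp.trans (le_of_eq ?_)
      field_simp

/-- A random variable with an independent noise component is at least of the size of the noise. -/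
lemma IsBoundedNoise.le_of_abs_add_le (h : IsBoundedNoise μ ξ r σ) (hr : 0 < r) {t : ℕ}
    (hF : F ≤ mΩ)
    (hind : Indep F (MeasurableSpace.comap (ξ t) inferInstance) μ)
    {c : Ω → ℝ} (hc : Measurable[F] c) {v : Vec k} (hv : 0 < ‖v‖) {b : ℝ}
    (hb : ∀ᵐ ω ∂μ, |c ω + inner ℝ v (ξ t ω)| ≤ b) : 2 / 3 * (‖v‖ * σ) ≤ b := by
  -- Otherwise there would almost surely be no hit, so the weight would have mean 1, against the
  -- strict contraction.
  by_contra! hlt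
  have h1 := h.lintegral_mul_hitWeight_le hr hF hind (Y := fun _ => 1) measurable_const hc hv le_rfl
  have h2 : ∫⁻ ω, (fun _ => (1 : ℝ≥0∞)) ω *
      ENNReal.ofReal (hitWeight (2 / 3 * (‖v‖ * σ)) (c ω + inner ℝ v (ξ t ω))) ∂μ = 1 := by
    rw [← measure_univ (μ := μ), ← lintegral_one]
    refine lintegral_congr_ae ?_
    filter_upwards [hb] with ω hω
    simp [hitWeight, if_neg (not_le.2 (hω.trans_lt hlt))]
  rw [h2] at h1
  have h3 := h.sigma_pos
  have h4 : Real.exp (-(σ ^ 2 / (18 * r ^ 2) / 2)) < 1 := by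
    rw [Real.exp_lt_one_iff]
    have : 0 < σ ^ 2 / (18 * r ^ 2) / 2 := by positivity
    linarith
  simp only [lintegral_const, measure_univ, mul_one, ENNReal.one_le_ofReal] at h1
  linarith

end NoiseStep

/-- The standing assumptions on the noises and the closed loop. -/
structure IsBoundedLoop {Ω : Type*} [MeasurableSpace Ω] (μ : Measure Ω) {n m : ℕ}
    (A : Matrix (Fin n) (Fin n) ℝ) (B : Matrix (Fin n) (Fin m) ℝ) (π : Policy n m)
    (w : ℕ → Ω → Vec n) (η : ℕ → Ω → Vec m) (x : ℕ → Ω → Vec n) (u : ℕ → Ω → Vec m)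
    (wmax σw ηmax ση bz : ℝ) : Prop where
  one_le_state : 1 ≤ n
  one_le_input : 1 ≤ m
  measurable_policy : ∀ t, Measurable (π t)
  noise_state : IsBoundedNoise μ w wmax σw
  noise_input : IsBoundedNoise μ η ηmax ση
  measurable_init : Measurable (x 0)
  indep_noise : IndepFun (fun ω t => w t ω) (fun ω t => η t ω) μ
  indep_init : IndepFun (x 0) (fun ω => ((fun t => w t ω), (fun t => η t ω))) μ
  loop : IsClosedLoop A B π w η x u
  bounded : ∀ᵐ ω ∂μ, ∀ t, √(‖x t ω‖ ^ 2 + ‖u t ω‖ ^ 2) ≤ bz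

/-! ### Excitation and martingale tails along the closed loop -/

namespace IsBoundedLoop

variable {Ω : Type*} {mΩ : MeasurableSpace Ω} {μ : Measure Ω} {n m : ℕ}
  {A : Matrix (Fin n) (Fin n) ℝ} {B : Matrix (Fin n) (Fin m) ℝ} {π : Policy n m}
  {w : ℕ → Ω → Vec n} {η : ℕ → Ω → Vec m} {x : ℕ → Ω → Vec n} {u : ℕ → Ω → Vec m}
  {wmax σw ηmax ση bz : ℝ}

lemma hist_le (h : IsBoundedLoop μ A B π w η x u wmax σw ηmax ση bz) (a b : ℕ) :
    hist (x 0) w η a b ≤ mΩ :=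
  SysId.hist_le h.measurable_init h.noise_state.measurable h.noise_input.measurable a b

lemma indep_state [IsProbabilityMeasure μ]
    (h : IsBoundedLoop μ A B π w η x u wmax σw ηmax ση bz) (a b : ℕ) :
    Indep (hist (x 0) w η a b) (MeasurableSpace.comap (w a) inferInstance) μ :=
  (indep_hist h.measurable_init h.noise_state.measurable h.noise_input.measurable
    h.noise_state.indep h.noise_input.indep h.indep_noise h.indep_init a b).1

lemma indep_input [IsProbabilityMeasure μ]
    (h : IsBoundedLoop μ A B π w η x u wmax σw ηmax ση bz) (a b : ℕ) :
    Indep (hist (x 0) w η a b) (MeasurableSpace.comap (η b) inferInstance) μ :=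
  (indep_hist h.measurable_init h.noise_state.measurable h.noise_input.measurable
    h.noise_state.indep h.noise_input.indep h.indep_noise h.indep_init a b).2

/-- The part of the next state that is known before the process noise is drawn. -/
lemma measurable_predict (h : IsBoundedLoop μ A B π w η x u wmax σw ηmax ση bz) (t : ℕ) :
    Measurable[hist (x 0) w η t (t + 1)] fun ω =>
      Matrix.toEuclideanLin A (x t ω) + Matrix.toEuclideanLin B (u t ω) := by
  obtain ⟨h1, -, h3⟩ := h.loop.measurable_hist h.measurable_policy t
  have hA : Measurable (Matrix.toEuclideanLin A) :=
    (LinearMap.continuous_of_finiteDimensional _).measurable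
  have hB : Measurable (Matrix.toEuclideanLin B) :=
    (LinearMap.continuous_of_finiteDimensional _).measurable
  exact (hA.comp (h1.mono (hist_mono le_rfl (by lia)) le_rfl)).add (hB.comp h3)

lemma measurable_inner_regressor (h : IsBoundedLoop μ A B π w η x u wmax σw ηmax ση bz) (t : ℕ)
    (v : Joint n m) :
    Measurable[hist (x 0) w η t (t + 1)] fun ω => inner ℝ v (joinVec (x t ω) (u t ω)) := by
  obtain ⟨h1, -, h3⟩ := h.loop.measurable_hist h.measurable_policy t
  simp_rw [inner_joinVec]
  have h1' : Measurable[hist (x 0) w η t (t + 1)] (x t) :=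
    h1.mono (hist_mono le_rfl (by lia)) le_rfl
  have f1 : Measurable fun z : Vec n => inner ℝ (statePart v) z := by fun_prop
  have f2 : Measurable fun z : Vec m => inner ℝ (inputPart v) z := by fun_prop
  exact (f1.comp h1').add (f2.comp h3)

lemma norm_state_le (h : IsBoundedLoop μ A B π w η x u wmax σw ηmax ση bz) :
    ∀ᵐ ω ∂μ, ∀ t, ‖x t ω‖ ≤ bz ∧ ‖u t ω‖ ≤ bz := by
  filter_upwards [h.bounded] with ω hω t
  exact ⟨(Real.le_sqrt_of_sq_le (by nlinarith [sq_nonneg ‖u t ω‖])).trans (hω t),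
    (Real.le_sqrt_of_sq_le (by nlinarith [sq_nonneg ‖x t ω‖])).trans (hω t)⟩

/-- x_1 contains the fresh noise w_0, so a bounded trajectory forces `bz` to be at least of order
σw. The analogous bound for ση comes from u_0. -/
lemma sigma_state_le [IsProbabilityMeasure μ]
    (h : IsBoundedLoop μ A B π w η x u wmax σw ηmax ση bz) :
    2 / 3 * σw ≤ bz := by
  let v : Vec n := EuclideanSpace.single ⟨0, h.one_le_state⟩ 1
  have hv : ‖v‖ = 1 := by simp [v]
  have f1 : Measurable fun z : Vec n => inner ℝ v z := by fun_prop
  have := h.noise_state.le_of_abs_add_le (h.noise_state.pos h.one_le_state) (h.hist_le 0 1)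
    (h.indep_state 0 1) (f1.comp (h.measurable_predict 0)) (v := v) (b := bz) (by simp [hv]) ?_
  · simpa [hv] using this
  · filter_upwards [h.norm_state_le] with ω hω
    rw [Function.comp, ← inner_add_right, ← h.loop.state]
    refine (abs_real_inner_le_norm _ _).trans ?_
    rw [hv, one_mul]
    exact (hω 1).1

lemma sigma_input_le [IsProbabilityMeasure μ]
    (h : IsBoundedLoop μ A B π w η x u wmax σw ηmax ση bz) :
    2 / 3 * ση ≤ bz := by
  let v : Vec m := EuclideanSpace.single ⟨0, h.one_le_input⟩ 1
  have hv : ‖v‖ = 1 := by simp [v]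
  have f1 : Measurable fun z : Vec m => inner ℝ v z := by fun_prop
  have := h.noise_input.le_of_abs_add_le (h.noise_input.pos h.one_le_input) (h.hist_le 0 0)
    (h.indep_input 0 0) (f1.comp (h.loop.measurable_hist h.measurable_policy 0).2.1) (v := v)
    (b := bz) (by simp [hv]) ?_
  · simpa [hv] using this
  · filter_upwards [h.norm_state_le] with ω hω
    rw [Function.comp, ← inner_add_right, ← h.loop.input]
    refine (abs_real_inner_le_norm _ _).trans ?_
    rw [hv, one_mul]
    exact (hω 0).2

/-- One step of excitation: conditionally on the past, every direction of the regressor is hit at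
scale `σw ση / (6 bz)` with probability at least `p`. -/
lemma lintegral_mul_hitWeight_le [IsProbabilityMeasure μ]
    (h : IsBoundedLoop μ A B π w η x u wmax σw ηmax ση bz) {p : ℝ}
    (hpw : p ≤ σw ^ 2 / (18 * wmax ^ 2)) (hpη : p ≤ ση ^ 2 / (18 * ηmax ^ 2)) (t : ℕ)
    {Y : Ω → ℝ≥0∞} (hY : Measurable[hist (x 0) w η t (t + 1)] Y) {v : Joint n m} (hv : 0 < ‖v‖) :
    ∫⁻ ω, Y ω * ENNReal.ofReal (hitWeight (σw * ση / (6 * bz) * ‖v‖)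
        (inner ℝ v (joinVec (x (t + 1) ω) (u (t + 1) ω)))) ∂μ
      ≤ ENNReal.ofReal (Real.exp (-(p / 2))) * ∫⁻ ω, Y ω ∂μ := by
  have hσw := h.noise_state.sigma_pos
  have hση := h.noise_input.sigma_pos
  have hbw := h.sigma_state_le
  have hbη := h.sigma_input_le
  have hbz : 0 < bz := by linarith
  have hsq := norm_sq_parts v
  set α := statePart v with hα
  set β := inputPart v with hβ
  have hα0 := norm_nonneg α
  have hβ0 := norm_nonneg β
  -- Above this threshold η_{t+1} alone gives a hit at scale (2/3)‖β‖ση. Below it, an input of norm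
  -- at most `bz` contributes at most σw‖v‖/4.
  by_cases hcase : σw / (4 * bz) * ‖v‖ ≤ ‖β‖
  · have hβpos : 0 < ‖β‖ := lt_of_lt_of_le (by positivity) hcase
    obtain ⟨h1, h2, -⟩ := h.loop.measurable_hist h.measurable_policy (t + 1)
    have f1 : Measurable fun z : Vec n => inner ℝ α z := by fun_prop
    have f2 : Measurable fun z : Vec m => inner ℝ β z := by fun_prop
    have step := h.noise_input.lintegral_mul_hitWeight_le (h.noise_input.pos h.one_le_input)
      (h.hist_le (t + 1) (t + 1)) (h.indep_input (t + 1) (t + 1))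
      (hY.mono (hist_mono (by lia) le_rfl) le_rfl) ((f1.comp h1).add (f2.comp h2)) hβpos hpη
    refine le_trans (lintegral_mono_ae (.of_forall fun ω => ?_)) step
    gcongr
    refine hitWeight_le_of_abs_le fun hle => ?_
    have e : inner ℝ v (joinVec (x (t + 1) ω) (u (t + 1) ω)) =
        ((fun z => inner ℝ α z) ∘ x (t + 1)) ω + ((fun z => inner ℝ β z) ∘ fun ω => π (t + 1)
          (x (t + 1) ω, fun s : Fin (t + 1) => (x s ω, u s ω, η s ω))) ω
          + inner ℝ β (η (t + 1) ω) := by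
      rw [inner_joinVec, h.loop.input (t + 1) ω, inner_add_right, ← add_assoc]; rfl
    rw [e]
    refine le_trans ?_ hle
    calc σw * ση / (6 * bz) * ‖v‖ = 2 / 3 * (σw / (4 * bz) * ‖v‖ * ση) := by
          field_simp; ring
      _ ≤ 2 / 3 * (‖β‖ * ση) := by gcongr
  · push Not at hcase
    have hr : σw / (4 * bz) ≤ 3 / 8 := by
      rw [div_le_iff₀ (by positivity)]; linarith
    have hβle : ‖β‖ ≤ 3 / 8 * ‖v‖ := hcase.le.trans (by gcongr)
    have hαge : 9 / 10 * ‖v‖ ≤ ‖α‖ := by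
      nlinarith
    have hαpos : 0 < ‖α‖ := lt_of_lt_of_le (by positivity) hαge
    have f1 : Measurable fun z : Vec n => inner ℝ α z := by fun_prop
    have step := h.noise_state.lintegral_mul_hitWeight_le (h.noise_state.pos h.one_le_state)
      (h.hist_le t (t + 1)) (h.indep_state t (t + 1)) hY (f1.comp (h.measurable_predict t))
      hαpos hpw
    refine le_trans (lintegral_mono_ae ?_) step
    filter_upwards [h.norm_state_le] with ω hω
    gcongr
    refine hitWeight_le_of_abs_le fun hle => ?_
    rw [Function.comp, ← inner_add_right, ← h.loop.state] at hle
    rw [inner_joinVec]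
    -- The input may depend on w_t in any way, so only its size is used. What remains is at least
    -- (0.6 - 0.25) σw‖v‖, which exceeds the required scale because ση ≤ (3/2) bz.
    have hu : |inner ℝ β (u (t + 1) ω)| ≤ σw / (4 * bz) * ‖v‖ * bz :=
      (abs_real_inner_le_norm _ _).trans (mul_le_mul hcase.le (hω (t + 1)).2 (norm_nonneg _)
        (by positivity))
    have e : σw / (4 * bz) * ‖v‖ * bz = σw * ‖v‖ / 4 := by field_simp
    have e2 : σw * ση / (6 * bz) * ‖v‖ ≤ σw * ‖v‖ / 4 := by
      rw [div_mul_eq_mul_div, div_le_iff₀ (by positivity)]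
      have : 0 < σw * ‖v‖ := by positivity
      nlinarith
    have h3 := abs_sub_abs_le_abs_add (inner ℝ α (x (t + 1) ω)) (inner ℝ β (u (t + 1) ω))
    have h4 : 2 / 3 * (9 / 10 * ‖v‖ * σw) ≤ 2 / 3 * (‖α‖ * σw) := by gcongr
    have h5 : 0 < σw * ‖v‖ := by positivity
    linarith

/-- Chernoff bound for the number of times a direction is hit. -/
lemma measure_hits_le [IsProbabilityMeasure μ]
    (h : IsBoundedLoop μ A B π w η x u wmax σw ηmax ση bz) {p : ℝ}
    (hpw : p ≤ σw ^ 2 / (18 * wmax ^ 2)) (hpη : p ≤ ση ^ 2 / (18 * ηmax ^ 2)) (N : ℕ)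
    {v : Joint n m} (hv : 0 < ‖v‖) :
    μ {ω | ∑ s ∈ Finset.range N, (if σw * ση / (6 * bz) * ‖v‖ ≤
        |inner ℝ v (joinVec (x (s + 1) ω) (u (s + 1) ω))| then (1 : ℝ) else 0) ≤ N * p / 4}
      ≤ ENNReal.ofReal (Real.exp (-(N * p / 4))) := by
  -- This product is exp(-number of hits). Each step contracts its mean by exp(-p/2), and Markov's
  -- inequality at level exp(-Np/4) gives back half of the exponent. Counting starts at time 1,
  -- since no process noise precedes x_0.
  set Y : ℕ → Ω → ℝ≥0∞ := fun k ω => ∏ s ∈ Finset.range k,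
    ENNReal.ofReal (hitWeight (σw * ση / (6 * bz) * ‖v‖)
      (inner ℝ v (joinVec (x (s + 1) ω) (u (s + 1) ω)))) with hYdef
  have hmeas : ∀ k, Measurable[hist (x 0) w η k (k + 1)] (Y k) := fun k => by
    refine @Finset.measurable_fun_prod _ _ _ _ _ _ (hist (x 0) w η k (k + 1)) _ _ fun s hs => ?_
    have hs' := Finset.mem_range.1 hs
    exact ENNReal.measurable_ofReal.comp ((measurable_hitWeight _).comp
      ((h.measurable_inner_regressor (s + 1) v).mono (hist_mono (by lia) (by lia)) le_rfl))
  have hint : ∀ k, ∫⁻ ω, Y k ω ∂μ ≤ ENNReal.ofReal (Real.exp (-(k * (p / 2)))) := fun k => by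
    induction k with
    | zero => simp [Y]
    | succ k ih =>
      have e : Y (k + 1) = fun ω => Y k ω * ENNReal.ofReal (hitWeight (σw * ση / (6 * bz) * ‖v‖)
          (inner ℝ v (joinVec (x (k + 1) ω) (u (k + 1) ω)))) := by
        ext ω; simp [Y, Finset.prod_range_succ]
      rw [e]
      refine (h.lintegral_mul_hitWeight_le hpw hpη k (hmeas k) hv).trans ?_
      calc _ ≤ ENNReal.ofReal (Real.exp (-(p / 2))) * ENNReal.ofReal (Real.exp (-(k * (p / 2)))) := by
            gcongr
        _ = _ := by
            rw [← ENNReal.ofReal_mul (Real.exp_pos _).le, ← Real.exp_add]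
            congr 2; push_cast; ring
  have hsub : {ω | ∑ s ∈ Finset.range N, (if σw * ση / (6 * bz) * ‖v‖ ≤
        |inner ℝ v (joinVec (x (s + 1) ω) (u (s + 1) ω))| then (1 : ℝ) else 0) ≤ N * p / 4}
      ⊆ {ω | ENNReal.ofReal (Real.exp (-(N * p / 4))) ≤ Y N ω} := by
    intro ω hω
    simp only [Set.mem_ofPred_eq] at hω ⊢
    rw [hYdef]
    simp only
    rw [← ENNReal.ofReal_prod_of_nonneg fun s _ => (hitWeight_pos _ _).le]
    refine ENNReal.ofReal_le_ofReal ?_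
    simp only [hitWeight]
    rw [← Real.exp_sum, Finset.sum_neg_distrib]
    exact Real.exp_le_exp.2 (by linarith)
  refine (measure_mono hsub).trans ?_
  have hne : ENNReal.ofReal (Real.exp (-(N * p / 4))) ≠ 0 := by simp [Real.exp_pos]
  refine (meas_ge_le_lintegral_div ((hmeas N).mono (h.hist_le _ _) le_rfl).aemeasurable hne
    ENNReal.ofReal_ne_top).trans ?_
  refine ENNReal.div_le_of_le_mul ((hint N).trans (le_of_eq ?_))
  rw [← ENNReal.ofReal_mul (Real.exp_pos _).le, ← Real.exp_add]
  congr 2; ring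

/-- Exponential tail of the noise martingale in a fixed direction, compensated by its quadratic
variation. -/
lemma measure_martingale_le [IsProbabilityMeasure μ]
    (h : IsBoundedLoop μ A B π w η x u wmax σw ηmax ση bz) (N : ℕ)
    (i : Fin n) (v : Joint n m) (l ℓ : ℝ) :
    μ {ω | ℓ ≤ l * ∑ s ∈ Finset.range N, w s ω i * inner ℝ v (joinVec (x s ω) (u s ω)) -
        l ^ 2 * wmax ^ 2 / 2 * ∑ s ∈ Finset.range N, inner ℝ v (joinVec (x s ω) (u s ω)) ^ 2}
      ≤ ENNReal.ofReal (Real.exp (-ℓ)) := by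
  let e : Vec n := EuclideanSpace.single i 1
  have he : ‖e‖ = 1 := by simp [e]
  have hew : ∀ s ω, inner ℝ e (w s ω) = w s ω i := fun s ω => by
    simp [e, EuclideanSpace.inner_single_left]
  set a : ℕ → Ω → ℝ := fun s ω => l * inner ℝ v (joinVec (x s ω) (u s ω)) with ha
  -- An exponential supermartingale: a_s is known before w_s is drawn, so Hoeffding's lemma bounds
  -- each conditional factor by 1.
  set Y : ℕ → Ω → ℝ≥0∞ := fun k ω => ∏ s ∈ Finset.range k,
    ENNReal.ofReal (Real.exp (a s ω * inner ℝ e (w s ω) - a s ω ^ 2 * wmax ^ 2 / 2)) with hYdef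
  have hameas : ∀ s, Measurable[hist (x 0) w η s (s + 1)] (a s) := fun s =>
    (h.measurable_inner_regressor s v).const_mul l
  have f1 : Measurable fun z : Vec n => inner ℝ e z := by fun_prop
  have f2 : Measurable fun q : ℝ × ℝ =>
    ENNReal.ofReal (Real.exp (q.1 * q.2 - q.1 ^ 2 * wmax ^ 2 / 2)) := by fun_prop
  have hmeas : ∀ k, Measurable[hist (x 0) w η k (k + 1)] (Y k) := fun k => by
    refine @Finset.measurable_fun_prod _ _ _ _ _ _ (hist (x 0) w η k (k + 1)) _ _ fun s hs => ?_
    have hs' := Finset.mem_range.1 hs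
    have h1 : Measurable[hist (x 0) w η k (k + 1)] (a s) :=
      (hameas s).mono (hist_mono (by lia) (by lia)) le_rfl
    have h2 : Measurable[hist (x 0) w η k (k + 1)] fun ω => inner ℝ e (w s ω) :=
      f1.comp (measurable_hist_left hs')
    exact f2.comp (h1.prodMk h2)
  have hint : ∀ k, ∫⁻ ω, Y k ω ∂μ ≤ 1 := fun k => by
    induction k with
    | zero => simp [Y]
    | succ k ih =>
      have eY : Y (k + 1) = fun ω => Y k ω *
          ENNReal.ofReal (Real.exp (a k ω * inner ℝ e (w k ω) - a k ω ^ 2 * wmax ^ 2 / 2)) := by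
        ext ω; simp [Y, Finset.prod_range_succ]
      rw [eY]
      refine (lintegral_mul_le_of_indepFun ((hmeas k).mono (h.hist_le _ _) le_rfl)
        ((hameas k).mono (h.hist_le _ _) le_rfl) (h.noise_state.measurable_inner k e)
        (indepFun_pair_inner (h.indep_state k (k + 1)) (hmeas k) (hameas k) e) f2
        (C := 1) fun c => ?_).trans (by rwa [one_mul])
      refine lintegral_exp_mul_sub_le_one (h.noise_state.measurable_inner k e) ?_
        (h.noise_state.integral_inner_eq_zero k e) c
      simpa [he] using h.noise_state.abs_inner_le k e
  have hsub : {ω | ℓ ≤ l * ∑ s ∈ Finset.range N, w s ω i * inner ℝ v (joinVec (x s ω) (u s ω)) -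
        l ^ 2 * wmax ^ 2 / 2 * ∑ s ∈ Finset.range N, inner ℝ v (joinVec (x s ω) (u s ω)) ^ 2}
      ⊆ {ω | ENNReal.ofReal (Real.exp ℓ) ≤ Y N ω} := by
    intro ω hω
    simp only [Set.mem_ofPred_eq] at hω ⊢
    rw [hYdef]
    simp only
    rw [← ENNReal.ofReal_prod_of_nonneg fun s _ => (Real.exp_pos _).le, ← Real.exp_sum]
    refine ENNReal.ofReal_le_ofReal (Real.exp_le_exp.2 (hω.trans (le_of_eq ?_)))
    rw [Finset.mul_sum, Finset.mul_sum, ← Finset.sum_sub_distrib]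
    refine Finset.sum_congr rfl fun s _ => ?_
    rw [hew]
    ring
  refine (measure_mono hsub).trans ?_
  have hne : ENNReal.ofReal (Real.exp ℓ) ≠ 0 := by simp [Real.exp_pos]
  refine (meas_ge_le_lintegral_div ((hmeas N).mono (h.hist_le _ _) le_rfl).aemeasurable hne
    ENNReal.ofReal_ne_top).trans ?_
  refine ENNReal.div_le_of_le_mul ((hint N).trans (le_of_eq ?_))
  rw [← ENNReal.ofReal_mul (Real.exp_pos _).le, ← Real.exp_add]
  simp

end IsBoundedLoop

/-! ### Finite nets of Euclidean balls -/

section Net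

/-- A grid net of a Euclidean ball. -/
lemma exists_finset_net (ι : Type*) [Fintype ι] [Nonempty ι] {R ε : ℝ} (hε : 0 < ε) :
    ∃ N : Finset (EuclideanSpace ℝ ι),
      (0 ≤ R → (N.card : ℝ) ≤ (2 * √(Fintype.card ι) * (R / ε) + 3) ^ Fintype.card ι) ∧
      ∀ v : EuclideanSpace ℝ ι, ‖v‖ ≤ R → ∃ v' ∈ N, ‖v - v'‖ ≤ ε := by
  classical
  have hd : (0 : ℝ) < Fintype.card ι := by exact_mod_cast Fintype.card_pos
  have hsd : 0 < √(Fintype.card ι : ℝ) := Real.sqrt_pos.2 hd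
  -- With this spacing, rounding each coordinate down moves the point by at most ε in Euclidean
  -- norm.
  set h : ℝ := ε / √(Fintype.card ι) with hh
  have hpos : 0 < h := by positivity
  set K : ℤ := ⌈R / h⌉ with hK
  refine ⟨(Fintype.piFinset fun _ : ι => Finset.Icc (-K) K).image
    fun f => WithLp.toLp 2 fun i => h * (f i : ℝ), fun hR => ?_, fun v hv => ?_⟩
  · have hK0 : 0 ≤ K := Int.ceil_nonneg (by positivity)
    calc _ ≤ (((Fintype.piFinset fun _ : ι => Finset.Icc (-K) K).card : ℕ) : ℝ) := by
          exact_mod_cast Finset.card_image_le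
      _ = ((Finset.Icc (-K) K).card : ℝ) ^ Fintype.card ι := by
          rw [Fintype.card_piFinset]; simp
      _ ≤ _ := by
          gcongr
          have e : ((Finset.Icc (-K) K).card : ℝ) = 2 * K + 1 := by
            rw [Int.card_Icc]
            have : ((K + 1 - -K).toNat : ℤ) = 2 * K + 1 := by
              rw [Int.toNat_of_nonneg (by lia)]; ring
            exact_mod_cast this
          rw [e]
          have h1 : (K : ℝ) < R / h + 1 := Int.ceil_lt_add_one _
          have h2 : R / h = √(Fintype.card ι) * (R / ε) := by
            rw [hh]; field_simp
          nlinarith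
  · have hvi : ∀ i, |v i| ≤ R := fun i => (PiLp.norm_apply_le v i).trans hv
    refine ⟨WithLp.toLp 2 fun i => h * (⌊v i / h⌋ : ℝ), ?_, ?_⟩
    · refine Finset.mem_image.2 ⟨fun i => ⌊v i / h⌋, ?_, rfl⟩
      rw [Fintype.mem_piFinset]
      intro i
      have := abs_le.1 (hvi i)
      rw [Finset.mem_Icc]
      constructor
      · rw [Int.le_floor, hK]
        push_cast
        have h3 : R / h ≤ (⌈R / h⌉ : ℝ) := Int.le_ceil _
        have h4 : -(R / h) ≤ v i / h := by
          rw [← neg_div]; gcongr; exact this.1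
        linarith
      · have h3 : (⌊v i / h⌋ : ℝ) ≤ (⌈R / h⌉ : ℝ) := by
          refine (Int.floor_le _).trans (le_trans ?_ (Int.le_ceil _))
          gcongr
          exact this.2
        exact_mod_cast h3
    · rw [EuclideanSpace.norm_eq]
      refine Real.sqrt_le_iff.2 ⟨hε.le, ?_⟩
      calc _ ≤ ∑ _i : ι, h ^ 2 := by
            refine Finset.sum_le_sum fun i _ => ?_
            have h1 := Int.floor_le (v i / h)
            have h2 := Int.lt_floor_add_one (v i / h)
            rw [le_div_iff₀ hpos] at h1
            rw [div_lt_iff₀ hpos] at h2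
            have h3 : |v i - h * (⌊v i / h⌋ : ℝ)| ≤ h := by
              rw [abs_le]; constructor <;> nlinarith
            simpa using sq_le_sq' (by linarith [(abs_le.1 h3).1]) (abs_le.1 h3).2
        _ = ε ^ 2 := by
            rw [Finset.sum_const, Finset.card_univ, nsmul_eq_mul, hh, div_pow,
              Real.sq_sqrt hd.le]
            field_simp

end Net

/-! ### Normal equations and reduction to rows -/

section LeastSquares

variable {n m : ℕ}

/-- The `i`-th row of a matrix with `n + m` columns. -/
noncomputable def rowVec (D : Matrix (Fin n) (Fin n ⊕ Fin m) ℝ) (i : Fin n) : Joint n m :=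
  WithLp.toLp 2 (D i)

lemma l2_opNorm_le_of_rows {D : Matrix (Fin n) (Fin n ⊕ Fin m) ℝ} {b : ℝ} (hb : 0 ≤ b)
    (h : ∀ i, ‖rowVec D i‖ ≤ b) : ‖D‖ ≤ √n * b := by
  rw [Matrix.l2_opNorm_def]
  refine ContinuousLinearMap.opNorm_le_bound _ (by positivity) fun v => ?_
  rw [EuclideanSpace.norm_eq]
  refine Real.sqrt_le_iff.2 ⟨by positivity, ?_⟩
  calc _ ≤ ∑ _i : Fin n, (b * ‖v‖) ^ 2 := by
        refine Finset.sum_le_sum fun i _ => ?_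
        have e : (Matrix.toEuclideanLin D v) i = inner ℝ (rowVec D i) v := by
          simp [Matrix.toLpLin_apply, Matrix.mulVec, dotProduct, rowVec, PiLp.inner_apply, mul_comm]
        have h1 : |inner ℝ (rowVec D i) v| ≤ b * ‖v‖ :=
          (abs_real_inner_le_norm _ _).trans (by gcongr; exact h i)
        rw [← e] at h1
        rw [Real.norm_eq_abs]
        exact pow_le_pow_left₀ (abs_nonneg _) h1 2
    _ = (√n * b * ‖v‖) ^ 2 := by
        rw [Finset.sum_const, Finset.card_univ, nsmul_eq_mul, Fintype.card_fin, mul_pow, mul_pow,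
          mul_pow, Real.sq_sqrt (Nat.cast_nonneg n)]
        ring

lemma sum_Icc_one_eq_sum_range (T : ℕ) (f : ℕ → ℝ) :
    ∑ s ∈ Finset.Icc 1 T, f s = ∑ s ∈ Finset.range T, f (s + 1) := by
  induction T with
  | zero => simp
  | succ T ih => rw [Finset.sum_Icc_succ_top (by lia), Finset.sum_range_succ, ih]

lemma eq_zero_of_forall_quadratic_nonneg {a b : ℝ} (h : ∀ c : ℝ, 0 ≤ c ^ 2 * b - 2 * c * a) :
    a = 0 := by
  have hb : 0 ≤ b := by linarith [h 1, h (-1)]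
  -- Near the minimizer a / b; the shift by 1 avoids dividing by zero when b = 0.
  have h1 := h (a / (b + 1))
  have e : (a / (b + 1)) ^ 2 * b - 2 * (a / (b + 1)) * a = -(a ^ 2 * (b + 2) / (b + 1) ^ 2) := by
    field_simp; ring
  rw [e] at h1
  by_contra ha
  have : 0 < a ^ 2 * (b + 2) / (b + 1) ^ 2 := by positivity
  linarith

lemma toEuclideanLin_apply_eq_inner {k l : ℕ} (C : Matrix (Fin k) (Fin l) ℝ) (a : Vec l)
    (i : Fin k) : Matrix.toEuclideanLin C a i = inner ℝ (WithLp.toLp 2 (C i) : Vec l) a := by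
  simp [Matrix.toLpLin_apply, Matrix.mulVec, dotProduct, PiLp.inner_apply, mul_comm]

/-- The normal equations for a least-squares estimate, row by row, in terms of the noise. -/
lemma IsLSE.normal_equation {T : ℕ} {x : ℕ → Vec n} {u : ℕ → Vec m} {w : ℕ → Vec n}
    {A Ahat : Matrix (Fin n) (Fin n) ℝ} {B Bhat : Matrix (Fin n) (Fin m) ℝ}
    (hx : ∀ t, x (t + 1) = Matrix.toEuclideanLin A (x t) + Matrix.toEuclideanLin B (u t) + w t)
    (h : IsLSE T x u Ahat Bhat) (i : Fin n) (y : Joint n m) :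
    ∑ s ∈ Finset.range T, w s i * inner ℝ y (joinVec (x s) (u s)) =
      ∑ s ∈ Finset.range T,
        inner ℝ (rowVec (Matrix.fromCols Ahat Bhat - Matrix.fromCols A B) i)
          (joinVec (x s) (u s)) * inner ℝ y (joinVec (x s) (u s)) := by
  set D := Matrix.fromCols Ahat Bhat - Matrix.fromCols A B with hD
  set r : ℕ → Vec n := fun s => x (s + 1) - Matrix.toEuclideanLin Ahat (x s)
    - Matrix.toEuclideanLin Bhat (u s) with hr
  have hri : ∀ s, r s i = w s i - inner ℝ (rowVec D i) (joinVec (x s) (u s)) := fun s => by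
    have e1 : inner ℝ (rowVec D i) (joinVec (x s) (u s)) =
        inner ℝ (WithLp.toLp 2 (Ahat i) - WithLp.toLp 2 (A i) : Vec n) (x s)
          + inner ℝ (WithLp.toLp 2 (Bhat i) - WithLp.toLp 2 (B i) : Vec m) (u s) := by
      rw [inner_joinVec]
      congr 2
    rw [e1, inner_sub_left, inner_sub_left, ← toEuclideanLin_apply_eq_inner,
      ← toEuclideanLin_apply_eq_inner, ← toEuclideanLin_apply_eq_inner,
      ← toEuclideanLin_apply_eq_inner]
    simp only [hr, hx, PiLp.sub_apply, PiLp.add_apply]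
    ring
  suffices h0 : ∑ s ∈ Finset.range T, inner ℝ y (joinVec (x s) (u s)) * r s i = 0 by
    rw [← sub_eq_zero, ← Finset.sum_sub_distrib, ← h0]
    refine Finset.sum_congr rfl fun s _ => ?_
    rw [hri]; ring
  refine eq_zero_of_forall_quadratic_nonneg
    (b := ∑ s ∈ Finset.range T, inner ℝ y (joinVec (x s) (u s)) ^ 2) fun c => ?_
  -- First variation: adding c·y to row i of the estimate changes only the i-th residual coordinate,
  -- by -c⟨y, z_s⟩.
  let A' : Matrix (Fin n) (Fin n) ℝ := Matrix.of fun k j =>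
    Ahat k j + if k = i then c * statePart y j else 0
  let B' : Matrix (Fin n) (Fin m) ℝ := Matrix.of fun k j =>
    Bhat k j + if k = i then c * inputPart y j else 0
  have hA' : ∀ a : Vec n, Matrix.toEuclideanLin A' a = Matrix.toEuclideanLin Ahat a +
      EuclideanSpace.single i (c * inner ℝ (statePart y) a) := fun a => by
    ext k
    rw [PiLp.add_apply, toEuclideanLin_apply_eq_inner, toEuclideanLin_apply_eq_inner]
    by_cases hk : k = i
    · subst hk
      simp [A', PiLp.inner_apply, mul_add, Finset.sum_add_distrib, Finset.mul_sum, mul_left_comm]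
    · simp [A', PiLp.inner_apply, hk]
  have hB' : ∀ a : Vec m, Matrix.toEuclideanLin B' a = Matrix.toEuclideanLin Bhat a +
      EuclideanSpace.single i (c * inner ℝ (inputPart y) a) := fun a => by
    ext k
    rw [PiLp.add_apply, toEuclideanLin_apply_eq_inner, toEuclideanLin_apply_eq_inner]
    by_cases hk : k = i
    · subst hk
      simp [B', PiLp.inner_apply, mul_add, Finset.sum_add_distrib, Finset.mul_sum, mul_left_comm]
    · simp [B', PiLp.inner_apply, hk]
  have hle := h A' B'
  unfold lsCost at hle
  rw [sum_Icc_one_eq_sum_range, sum_Icc_one_eq_sum_range] at hle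
  have hterm : ∀ s, ‖x (s + 1) - Matrix.toEuclideanLin A' (x (s + 1 - 1))
      - Matrix.toEuclideanLin B' (u (s + 1 - 1))‖ ^ 2 = ‖r s‖ ^ 2
        + (c ^ 2 * inner ℝ y (joinVec (x s) (u s)) ^ 2
          - 2 * c * (inner ℝ y (joinVec (x s) (u s)) * r s i)) := fun s => by
    have e : x (s + 1) - Matrix.toEuclideanLin A' (x (s + 1 - 1))
        - Matrix.toEuclideanLin B' (u (s + 1 - 1))
          = r s - EuclideanSpace.single i (c * inner ℝ y (joinVec (x s) (u s))) := by
      rw [hA', hB', inner_joinVec, mul_add]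
      ext k
      by_cases hk : k = i
      · subst hk; simp [hr]; ring
      · simp [hr, hk]
    rw [e, norm_sub_sq_real, EuclideanSpace.inner_single_right, PiLp.norm_single]
    simp only [Real.norm_eq_abs, sq_abs, conj_trivial]
    ring
  simp only [hterm, Finset.sum_add_distrib, Finset.sum_sub_distrib, ← Finset.mul_sum] at hle
  have hr' : ∀ s, x (s + 1) - Matrix.toEuclideanLin Ahat (x (s + 1 - 1))
      - Matrix.toEuclideanLin Bhat (u (s + 1 - 1)) = r s := fun s => rfl
  simp only [hr'] at hle
  linarith

end LeastSquares

/-! ### Deterministic consequences of the two net estimates -/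

section Deterministic

variable {E : Type*} [NormedAddCommGroup E] [InnerProductSpace ℝ E]

/-- Frequent hits on a net of the unit ball give a lower bound on the empirical covariance. -/
lemma le_sum_inner_sq_of_hits {z : ℕ → E} {k : ℕ} {b τ a : ℝ} (hb : 0 < b) (hτ : 0 < τ)
    (hτb : τ ≤ 2 * b) (hz : ∀ s, ‖z s‖ ≤ b) {N : Finset E}
    (hN : ∀ v, ‖v‖ ≤ 1 → ∃ v' ∈ N, ‖v - v'‖ ≤ τ / (4 * b))
    (hits : ∀ v' ∈ N, 1 / 2 ≤ ‖v'‖ →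
      a ≤ ∑ s ∈ Finset.range k, if τ * ‖v'‖ ≤ |inner ℝ v' (z (s + 1))| then (1 : ℝ) else 0)
    (v : E) :
    a * (τ ^ 2 / 16) * ‖v‖ ^ 2 ≤ ∑ s ∈ Finset.range (k + 1), inner ℝ v (z s) ^ 2 := by
  have unit : ∀ v : E, ‖v‖ = 1 →
      a * (τ ^ 2 / 16) ≤ ∑ s ∈ Finset.range (k + 1), inner ℝ v (z s) ^ 2 := by
    intro v hv
    obtain ⟨v', hv'N, hv'⟩ := hN v hv.le
    have h1 : τ / (4 * b) ≤ 1 / 2 := by rw [div_le_iff₀ (by positivity)]; linarith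
    have h2 : 1 / 2 ≤ ‖v'‖ := by
      have := norm_sub_norm_le v v'
      linarith
    -- A hit for v' gives |⟨v', z⟩| ≥ τ/2, and passing to v loses at most τ/4, so each hit
    -- contributes at least τ²/16.
    calc a * (τ ^ 2 / 16)
        ≤ (∑ s ∈ Finset.range k, if τ * ‖v'‖ ≤ |inner ℝ v' (z (s + 1))| then (1 : ℝ) else 0)
            * (τ ^ 2 / 16) := by gcongr; exact hits v' hv'N h2
      _ ≤ ∑ s ∈ Finset.range k, inner ℝ v (z (s + 1)) ^ 2 := by
          rw [Finset.sum_mul]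
          refine Finset.sum_le_sum fun s _ => ?_
          split_ifs with h3
          · have h4 : |inner ℝ (v - v') (z (s + 1))| ≤ τ / 4 := by
              refine (abs_real_inner_le_norm _ _).trans ?_
              calc _ ≤ τ / (4 * b) * b := mul_le_mul hv' (hz _) (norm_nonneg _) (by positivity)
                _ = τ / 4 := by field_simp
            rw [inner_sub_left] at h4
            have h5 : τ / 2 ≤ τ * ‖v'‖ := by nlinarith
            have h6 : τ / 4 ≤ |inner ℝ v (z (s + 1))| := by
              have := abs_sub_abs_le_abs_sub (inner ℝ v' (z (s + 1))) (inner ℝ v (z (s + 1)))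
              rw [abs_sub_comm] at h4
              linarith
            rw [← sq_abs (inner ℝ v (z (s + 1)))]
            nlinarith
          · rw [zero_mul]; positivity
      _ ≤ _ := by
          rw [Finset.sum_range_succ']
          linarith [sq_nonneg (inner ℝ v (z 0))]
  by_cases hv : v = 0
  · subst hv; simp
  have hv0 : 0 < ‖v‖ := norm_pos_iff.2 hv
  have h1 := unit ((‖v‖⁻¹ : ℝ) • v) (by rw [norm_smul, norm_inv, norm_norm]; field_simp)
  have e : ∀ s, inner ℝ ((‖v‖⁻¹ : ℝ) • v) (z s) ^ 2 = inner ℝ v (z s) ^ 2 / ‖v‖ ^ 2 := fun s => by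
    rw [real_inner_smul_left]; field_simp
  simp only [e, ← Finset.sum_div] at h1
  rwa [le_div_iff₀ (by positivity)] at h1

/-- Self-normalized bound: control of the noise functional on a net of the ball of radius `1 / l`
bounds the solution of the normal equations. -/
lemma norm_le_of_normal_equation {T : ℕ} (hT : 0 < T) {z : ℕ → E} {g : ℕ → ℝ} {e : E} {b l K : ℝ}
    (hb : 0 < b) (hl : 0 < l) (hK : 0 ≤ K) (hz : ∀ s, ‖z s‖ ≤ b)
    (normal : ∀ y, ∑ s ∈ Finset.range T, g s * inner ℝ y (z s) =
      ∑ s ∈ Finset.range T, inner ℝ e (z s) * inner ℝ y (z s))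
    (hlow : ∀ v : E, l ^ 2 * ‖v‖ ^ 2 ≤ ∑ s ∈ Finset.range T, inner ℝ v (z s) ^ 2)
    {N : Finset E} (hN : ∀ v, ‖v‖ ≤ 1 / l → ∃ v' ∈ N, ‖v - v'‖ ≤ 1 / (4 * √T * b))
    (hM : ∀ v' ∈ N, ∑ s ∈ Finset.range T, g s * inner ℝ v' (z s) ≤
      K * (17 + (∑ s ∈ Finset.range T, inner ℝ v' (z s) ^ 2) / 2)) :
    l * ‖e‖ ≤ 24 * K := by
  have hT' : (0 : ℝ) < T := by exact_mod_cast hT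
  set Q : E → ℝ := fun v => ∑ s ∈ Finset.range T, inner ℝ v (z s) ^ 2 with hQ
  have hQ0 : ∀ v, 0 ≤ Q v := fun v => Finset.sum_nonneg fun s _ => sq_nonneg _
  set q := √(Q e) with hq
  have hq2 : q ^ 2 = Q e := Real.sq_sqrt (hQ0 e)
  have hq0 : 0 ≤ q := Real.sqrt_nonneg _
  have hle : l * ‖e‖ ≤ q := by
    refine Real.le_sqrt_of_sq_le ?_
    rw [mul_pow]
    exact hlow e
  refine hle.trans ?_
  rcases hq0.eq_or_lt with h0 | hqpos
  · rw [← h0]; positivity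
  -- The error normalized in the empirical seminorm: Q(y) = 1, so the lower bound on Q puts y in the
  -- ball of radius 1/l.
  set y : E := q⁻¹ • e with hy
  have hyin : ∀ s, inner ℝ y (z s) = q⁻¹ * inner ℝ e (z s) := fun s => real_inner_smul_left _ _ _
  have hQy : Q y = 1 := by
    simp only [hQ, hyin, mul_pow, ← Finset.mul_sum]
    change q⁻¹ ^ 2 * Q e = 1
    rw [← hq2]; field_simp
  have hynorm : ‖y‖ ≤ 1 / l := by
    have h1 := hlow y
    change _ ≤ Q y at h1
    rw [hQy, ← mul_pow] at h1
    rw [le_div_iff₀ hl, mul_comm]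
    exact (sq_le_one_iff₀ (by positivity)).1 h1
  obtain ⟨y', hy'N, hy'⟩ := hN y hynorm
  have hQd : Q (y - y') ≤ 1 / 16 := by
    calc Q (y - y') ≤ ∑ _s ∈ Finset.range T, (1 / (4 * √T * b) * b) ^ 2 := by
          refine Finset.sum_le_sum fun s _ => ?_
          have h1 : |inner ℝ (y - y') (z s)| ≤ 1 / (4 * √T * b) * b :=
            (abs_real_inner_le_norm _ _).trans
              (mul_le_mul hy' (hz s) (norm_nonneg _) (by positivity))
          rw [← sq_abs]
          exact pow_le_pow_left₀ (abs_nonneg _) h1 2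
      _ = 1 / 16 := by
          have : (1 / (4 * √(T : ℝ) * b) * b) ^ 2 = 1 / (16 * T) := by
            rw [mul_pow, div_pow, mul_pow, mul_pow, Real.sq_sqrt hT'.le]
            field_simp; norm_num
          rw [Finset.sum_const, Finset.card_range, nsmul_eq_mul, this]
          field_simp
  have hQy' : Q y' ≤ 2 := by
    -- Young's inequality with parameter 1/4. Then Q(y') ≤ 2 gives M(y') ≤ 18K, while M(y') ≥ (3/4)q
    -- by Cauchy–Schwarz; hence the constant 24.
    have : Q y' ≤ 5 / 4 * Q y + 5 * Q (y - y') := by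
      simp only [hQ, Finset.mul_sum, ← Finset.sum_add_distrib]
      refine Finset.sum_le_sum fun s _ => ?_
      rw [inner_sub_left]
      nlinarith [sq_nonneg (inner ℝ y (z s) / 2 - 2 * (inner ℝ y (z s) - inner ℝ y' (z s)))
        , sq_nonneg (inner ℝ y (z s) / 2 + 2 * (inner ℝ y (z s) - inner ℝ y' (z s)))]
    rw [hQy] at this
    linarith
  have hMy' := hM y' hy'N
  rw [normal y'] at hMy'
  have hsplit : ∑ s ∈ Finset.range T, inner ℝ e (z s) * inner ℝ y' (z s) =
      q - ∑ s ∈ Finset.range T, inner ℝ e (z s) * inner ℝ (y - y') (z s) := by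
    have h1 : q = ∑ s ∈ Finset.range T, inner ℝ e (z s) * inner ℝ y (z s) := by
      have e1 : ∀ s, inner ℝ e (z s) * inner ℝ y (z s) = q⁻¹ * inner ℝ e (z s) ^ 2 := fun s => by
        rw [hyin]; ring
      simp only [e1, ← Finset.mul_sum]
      change q = q⁻¹ * Q e
      rw [← hq2]; field_simp
    conv_rhs => rw [h1]
    rw [← Finset.sum_sub_distrib]
    refine Finset.sum_congr rfl fun s _ => ?_
    rw [inner_sub_left]; ring
  have hcs : ∑ s ∈ Finset.range T, inner ℝ e (z s) * inner ℝ (y - y') (z s) ≤ q / 4 := by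
    have h1 := Finset.sum_mul_sq_le_sq_mul_sq (Finset.range T) (fun s => inner ℝ e (z s))
      (fun s => inner ℝ (y - y') (z s))
    refine abs_le_of_sq_le_sq' ?_ (by positivity) |>.2
    refine h1.trans ?_
    change Q e * Q (y - y') ≤ _
    rw [← hq2]
    nlinarith [sq_nonneg q]
  change _ ≤ K * (17 + Q y' / 2) at hMy'
  have : K * (17 + Q y' / 2) ≤ K * 18 := by gcongr; linarith
  linarith

end Deterministic

/-! ### Absorbing the constants into the logarithm -/

section Constants

variable {a b σw ση bz δ : ℝ} {n m : ℕ}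

/-- The argument of the logarithm dominates all the constants of the problem. -/
lemma log_argument_bounds (hσw : 0 < σw) (hση : 0 < ση) (ha : 0 < a) (hb : 0 < b)
    (hn : 1 ≤ n) (hm : 1 ≤ m) (hna : (n : ℝ) ≤ a ^ 2) (hmb : (m : ℝ) ≤ b ^ 2)
    (hbw : 2 / 3 * σw ≤ bz) (hδ : 0 < δ) (hδ' : δ < 1 / 3) :
    2 ≤ bz / δ * poly₁ a b σw ση ∧ 1 / δ ≤ (bz / δ * poly₁ a b σw ση) ^ 2 ∧
      √((m : ℝ) + n) * (bz ^ 2 / (σw * ση)) * max a b ≤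
        3 / 2 * (bz / δ * poly₁ a b σw ση) ^ 2 ∧ 0 < poly₁ a b σw ση := by
  have hn' : (1 : ℝ) ≤ n := by exact_mod_cast hn
  have hm' : (1 : ℝ) ≤ m := by exact_mod_cast hm
  have ha1 : 1 ≤ a := by nlinarith
  have hb1 : 1 ≤ b := by nlinarith
  set M := max a b with hM
  have haM : a ≤ M := le_max_left _ _
  have hbM : b ≤ M := le_max_right _ _
  have hM1 : 1 ≤ M := ha1.trans haM
  have hbz : 0 < bz := by linarith
  set p := poly₁ a b σw ση with hp
  have hpw : M / σw ≤ p := by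
    calc M / σw = 1 / σw * M := by ring
      _ ≤ a / σw * M := by gcongr
      _ ≤ p := by
        rw [hp, poly₁]; gcongr; exact (le_max_left _ _).trans (le_max_left _ _)
  have hpη : M / ση ≤ p := by
    calc M / ση = 1 / ση * M := by ring
      _ ≤ b / ση * M := by gcongr
      _ ≤ p := by
        rw [hp, poly₁]; gcongr; exact (le_max_right _ _).trans (le_max_left _ _)
  have hp0 : 0 < p := lt_of_lt_of_le (by positivity) hpw
  set P := bz * p with hP
  have hPM : 2 / 3 * M ≤ P := by
    calc 2 / 3 * M = 2 / 3 * σw * (M / σw) := by field_simp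
      _ ≤ bz * p := by gcongr
  have hP0 : 0 < P := by positivity
  have hΛ : bz / δ * p = P / δ := by rw [hP]; ring
  rw [hΛ]
  -- With P = bz·`poly₁`, the bounds P ≥ 2/3 and δ < 1/3 give P/δ ≥ 2 and 1/δ ≤ (3/2)(P/δ).
  have hPΛ : P ≤ P / δ := by
    rw [le_div_iff₀ hδ]; nlinarith
  have hS : bz ^ 2 / (σw * ση) * M ^ 2 ≤ P ^ 2 := by
    calc bz ^ 2 / (σw * ση) * M ^ 2 = bz ^ 2 * (M / σw * (M / ση)) := by field_simp
      _ ≤ bz ^ 2 * (p * p) := by gcongr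
      _ = P ^ 2 := by rw [hP]; ring
  have hd : √((m : ℝ) + n) ≤ 3 / 2 * M := by
    refine Real.sqrt_le_iff.2 ⟨by positivity, ?_⟩
    have h1 : a ^ 2 ≤ M ^ 2 := by gcongr
    have h2 : b ^ 2 ≤ M ^ 2 := by gcongr
    nlinarith
  have hΛ2 : 2 ≤ P / δ := by
    rw [le_div_iff₀ hδ]; nlinarith
  refine ⟨hΛ2, ?_, ?_, hp0⟩
  · have h1 : 1 / δ ≤ 3 / 2 * (P / δ) := by
      rw [div_le_iff₀ hδ]
      have : 3 / 2 * (P / δ) * δ = 3 / 2 * P := by field_simp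
      rw [this]; nlinarith
    nlinarith
  · calc √((m : ℝ) + n) * (bz ^ 2 / (σw * ση)) * M
        ≤ 3 / 2 * M * (bz ^ 2 / (σw * ση)) * M := by gcongr
      _ = 3 / 2 * (bz ^ 2 / (σw * ση) * M ^ 2) := by ring
      _ ≤ 3 / 2 * P ^ 2 := by gcongr
      _ ≤ 3 / 2 * (P / δ) ^ 2 := by gcongr

/-- Turns a net cardinality c^d with c at most polynomial in X into exp(k d log X). -/
lemma pow_le_exp_mul_log {X c : ℝ} {k d : ℕ} (hc0 : 0 ≤ c) (hX : 0 < X) (h : c ≤ X ^ k) :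
    c ^ d ≤ Real.exp (k * (d * Real.log X)) := by
  have e : Real.exp (k * (d * Real.log X)) = (X ^ k) ^ d := by
    rw [← Real.exp_log hX, ← Real.exp_nat_mul, ← Real.exp_nat_mul, Real.log_exp]
    congr 1; ring
  rw [e]
  gcongr

end Constants

lemma measure_biUnion_finset_le_mul {Ω ι : Type*} [MeasurableSpace Ω] {μ : Measure Ω}
    (S : Finset ι) (f : ι → Set Ω) {c : ℝ}
    (h : ∀ i ∈ S, μ (f i) ≤ ENNReal.ofReal c) :
    μ (⋃ i ∈ S, f i) ≤ ENNReal.ofReal (S.card * c) := by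
  refine (measure_biUnion_finset_le S f).trans ((Finset.sum_le_sum h).trans (le_of_eq ?_))
  rw [Finset.sum_const, nsmul_eq_mul, ENNReal.ofReal_mul (Nat.cast_nonneg _),
    ENNReal.ofReal_natCast]

/-! ### The two high-probability events and their combination -/

namespace IsBoundedLoop

variable {Ω : Type*} {mΩ : MeasurableSpace Ω} {μ : Measure Ω} {n m : ℕ}
  {A : Matrix (Fin n) (Fin n) ℝ} {B : Matrix (Fin n) (Fin m) ℝ} {π : Policy n m}
  {w : ℕ → Ω → Vec n} {η : ℕ → Ω → Vec m} {x : ℕ → Ω → Vec n} {u : ℕ → Ω → Vec m}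
  {wmax σw ηmax ση bz : ℝ}

/-- With high probability the empirical covariance of the regressors is bounded below. -/
lemma exists_excitation_event [IsProbabilityMeasure μ]
    (h : IsBoundedLoop μ A B π w η x u wmax σw ηmax ση bz) {p c δ : ℝ} (hp : 0 ≤ p)
    (hpw : p ≤ σw ^ 2 / (18 * wmax ^ 2)) (hpη : p ≤ ση ^ 2 / (18 * ηmax ^ 2)) {T : ℕ}
    (hT : 2 ≤ T) (hc : 48 * √((m : ℝ) + n) * (bz ^ 2 / (σw * ση)) + 3 ≤ c)
    (hδ : c ^ (n + m) * Real.exp (-(T * p / 8)) ≤ δ) :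
    ∃ bad : Set Ω, μ bad ≤ ENNReal.ofReal δ ∧ ∀ ω ∉ bad,
      (∀ t, √(‖x t ω‖ ^ 2 + ‖u t ω‖ ^ 2) ≤ bz) → ∀ v : Joint n m,
        T * p / 8 * ((σw * ση / (6 * bz)) ^ 2 / 16) * ‖v‖ ^ 2 ≤
          ∑ s ∈ Finset.range T, inner ℝ v (joinVec (x s ω) (u s ω)) ^ 2 := by
  have hσw := h.noise_state.sigma_pos
  have hση := h.noise_input.sigma_pos
  have hbw := h.sigma_state_le
  have hbη := h.sigma_input_le
  have hbz : 0 < bz := by linarith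
  set τ := σw * ση / (6 * bz) with hτ
  have hτ0 : 0 < τ := by positivity
  have : Nonempty (Fin n ⊕ Fin m) := ⟨Sum.inl ⟨0, h.one_le_state⟩⟩
  obtain ⟨N, hcard, hN⟩ := exists_finset_net (Fin n ⊕ Fin m) (R := 1) (ε := τ / (4 * bz))
    (by positivity)
  obtain ⟨k, rfl⟩ : ∃ k, T = k + 1 := ⟨T - 1, by lia⟩
  -- Time 0 is not counted, leaving k = T - 1 ≥ T/2 usable steps.
  have hk : ((k + 1 : ℕ) : ℝ) * p / 8 ≤ k * p / 4 := by
    have : (1 : ℝ) ≤ k := by exact_mod_cast (by lia : 1 ≤ k)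
    push_cast
    nlinarith
  refine ⟨⋃ v ∈ N.filter fun v => 1 / 2 ≤ ‖v‖, {ω | ∑ s ∈ Finset.range k,
    (if τ * ‖v‖ ≤ |inner ℝ v (joinVec (x (s + 1) ω) (u (s + 1) ω))| then (1 : ℝ) else 0)
      ≤ k * p / 4}, ?_, ?_⟩
  · refine (measure_biUnion_finset_le_mul _ _ (c := Real.exp (-(k * p / 4))) fun v hv => ?_).trans
      (ENNReal.ofReal_le_ofReal ?_)
    · exact h.measure_hits_le hpw hpη k (by linarith [(Finset.mem_filter.1 hv).2])
    · refine le_trans (mul_le_mul ?_ (Real.exp_le_exp.2 (neg_le_neg hk)) (Real.exp_pos _).le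
        (pow_nonneg (le_trans (by positivity) hc) _)) hδ
      · calc (((N.filter fun v => 1 / 2 ≤ ‖v‖).card : ℕ) : ℝ) ≤ N.card := by
              exact_mod_cast Finset.card_filter_le _ _
          _ ≤ _ := hcard zero_le_one
          _ ≤ c ^ (n + m) := by
              rw [Fintype.card_sum, Fintype.card_fin, Fintype.card_fin]
              gcongr
              refine le_trans (le_of_eq ?_) hc
              rw [hτ]
              push_cast
              rw [add_comm (n : ℝ)]
              field_simp
              ring
  · intro ω hω hbd v
    have hz : ∀ s, ‖joinVec (x s ω) (u s ω)‖ ≤ bz := fun s => by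
      rw [norm_joinVec]; exact hbd s
    refine le_sum_inner_sq_of_hits (z := fun s => joinVec (x s ω) (u s ω)) hbz hτ0 ?_ hz hN ?_ v
    · rw [hτ, div_le_iff₀ (by positivity)]
      nlinarith
    · intro v' hv' hhalf
      by_contra! hlt
      refine hω (Set.mem_biUnion (Finset.mem_coe.2 (Finset.mem_filter.2 ⟨hv', hhalf⟩)) ?_)
      exact hlt.le.trans hk

/-- With high probability the noise functionals are controlled on a net. -/
lemma exists_martingale_event [IsProbabilityMeasure μ]
    (h : IsBoundedLoop μ A B π w η x u wmax σw ηmax ση bz) (T : ℕ) (N : Finset (Joint n m))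
    {q δ : ℝ} (hq : 0 < q) (hδ : n * (N.card * Real.exp (-(17 * q))) ≤ δ) :
    ∃ bad : Set Ω, μ bad ≤ ENNReal.ofReal δ ∧ ∀ ω ∉ bad, ∀ i, ∀ v ∈ N,
      ∑ s ∈ Finset.range T, w s ω i * inner ℝ v (joinVec (x s ω) (u s ω)) ≤
        wmax * √q * (17 + (∑ s ∈ Finset.range T, inner ℝ v (joinVec (x s ω) (u s ω)) ^ 2) / 2) := by
  have hwmax := h.noise_state.pos h.one_le_state
  -- The tilt √q / wmax makes the compensator exactly (q/2)·Q(v), so level 17q rearranges to the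
  -- claimed bound.
  refine ⟨⋃ i ∈ (Finset.univ : Finset (Fin n)), ⋃ v ∈ N, {ω | 17 * q ≤
    √q / wmax * ∑ s ∈ Finset.range T, w s ω i * inner ℝ v (joinVec (x s ω) (u s ω)) -
    (√q / wmax) ^ 2 * wmax ^ 2 / 2 *
      ∑ s ∈ Finset.range T, inner ℝ v (joinVec (x s ω) (u s ω)) ^ 2}, ?_, ?_⟩
  · refine (measure_biUnion_finset_le_mul _ _ (c := N.card * Real.exp (-(17 * q)))
      fun i _ => ?_).trans (ENNReal.ofReal_le_ofReal (by simpa using hδ))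
    exact measure_biUnion_finset_le_mul _ _ fun v _ =>
      h.measure_martingale_le T i v _ _
  · intro ω hω i v hv
    have h1 : ¬ (17 * q ≤
        √q / wmax * ∑ s ∈ Finset.range T, w s ω i * inner ℝ v (joinVec (x s ω) (u s ω)) -
        (√q / wmax) ^ 2 * wmax ^ 2 / 2 *
          ∑ s ∈ Finset.range T, inner ℝ v (joinVec (x s ω) (u s ω)) ^ 2) := fun hle =>
      hω (Set.mem_biUnion (Finset.mem_coe.2 (Finset.mem_univ i))
        (Set.mem_biUnion (Finset.mem_coe.2 hv) hle))
    push Not at h1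
    have hsq : 0 < √q := Real.sqrt_pos.2 hq
    have e1 : (√q / wmax) ^ 2 * wmax ^ 2 = q := by
      rw [div_pow, Real.sq_sqrt hq.le]; field_simp
    rw [e1] at h1
    have h2 : √q / wmax * ∑ s ∈ Finset.range T, w s ω i * inner ℝ v (joinVec (x s ω) (u s ω)) ≤
        √q / wmax * (wmax * √q *
          (17 + (∑ s ∈ Finset.range T, inner ℝ v (joinVec (x s ω) (u s ω)) ^ 2) / 2)) := by
      have e2 : ∀ r : ℝ, √q / wmax * (wmax * √q * r) = q * r := fun r => by
        calc _ = √q * √q * r := by field_simp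
          _ = q * r := by rw [Real.mul_self_sqrt hq.le]
      rw [e2]
      linarith
    exact le_of_mul_le_mul_left h2 (by positivity)

set_option maxHeartbeats 1000000 in
/-- The estimation error in terms of the noise level, with explicit constants. -/
lemma exists_bad_event [IsProbabilityMeasure μ]
    (h : IsBoundedLoop μ A B π w η x u wmax σw ηmax ση bz) {δ : ℝ} (hδ : 0 < δ) (hδ' : δ < 1 / 3)
    {M L : ℝ} (hM : M = max (wmax / σw) (ηmax / ση))
    (hL : L = Real.log (bz / δ * poly₁ (wmax / σw) (ηmax / ση) σw ση)) {T : ℕ}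
    (hT : 2000 * (((m : ℝ) + n) * M ^ 2 * L) ≤ T) :
    ∃ bad : Set Ω, μ bad ≤ ENNReal.ofReal (2 * δ) ∧ ∀ ω ∉ bad,
      ∀ (Ahat : Matrix (Fin n) (Fin n) ℝ) (Bhat : Matrix (Fin n) (Fin m) ℝ),
        IsLSE T (fun t => x t ω) (fun t => u t ω) Ahat Bhat →
        ‖Matrix.fromCols Ahat Bhat - Matrix.fromCols A B‖ ≤
          √n * (24 * (wmax * √(((m : ℝ) + n) * L)) / (√T * (σw * ση / (6 * bz)) / (48 * M))) := by
  have hσw := h.noise_state.sigma_pos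
  have hση := h.noise_input.sigma_pos
  have hbw := h.sigma_state_le
  have hbη := h.sigma_input_le
  have hbz : 0 < bz := by linarith
  have hw := h.noise_state.pos h.one_le_state
  have hη := h.noise_input.pos h.one_le_input
  have ha : 0 < wmax / σw := by positivity
  have hb : 0 < ηmax / ση := by positivity
  have hna : (n : ℝ) ≤ (wmax / σw) ^ 2 := by
    rw [div_pow, le_div_iff₀ (by positivity)]; exact h.noise_state.card_mul_sq_le
  have hmb : (m : ℝ) ≤ (ηmax / ση) ^ 2 := by
    rw [div_pow, le_div_iff₀ (by positivity)]; exact h.noise_input.card_mul_sq_le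
  have hn1 : (1 : ℝ) ≤ n := by exact_mod_cast h.one_le_state
  have hm1 : (1 : ℝ) ≤ m := by exact_mod_cast h.one_le_input
  obtain ⟨hΛ2, hΛδ, hΛS, -⟩ := log_argument_bounds hσw hση ha hb h.one_le_state h.one_le_input
    hna hmb hbw hδ hδ'
  rw [← hM] at hΛS
  set Λ := bz / δ * poly₁ (wmax / σw) (ηmax / ση) σw ση with hΛ
  have hΛ0 : 0 < Λ := by linarith
  have haM : wmax / σw ≤ M := hM ▸ le_max_left _ _
  have hbM : ηmax / ση ≤ M := hM ▸ le_max_right _ _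
  have hM1 : 1 ≤ M := by nlinarith
  have hL2 : 1 / 2 < L := by
    have h1 : Real.log 2 ≤ L := hL ▸ Real.log_le_log (by norm_num) hΛ2
    linarith [Real.log_two_gt_d9]
  set d : ℝ := (m : ℝ) + n with hd
  have hd2 : 2 ≤ d := by linarith
  have hdcast : ((n + m : ℕ) : ℝ) = d := by push_cast; ring
  have hdL : 1 ≤ d * L := by nlinarith
  have hT2' : (2 : ℝ) ≤ T := by
    have : 1 * 1 ≤ M ^ 2 * (d * L) := by gcongr; nlinarith
    linarith
  have hT2 : 2 ≤ T := by exact_mod_cast hT2'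
  have hδexp : Real.exp (-(2 * (d * L))) ≤ δ := by
    have h1 : Real.exp (2 * L) = Λ ^ 2 := by
      rw [hL, mul_comm, Real.exp_mul, Real.exp_log hΛ0]; norm_cast
    rw [Real.exp_neg, inv_le_comm₀ (Real.exp_pos _) hδ, ← one_div]
    refine hΛδ.trans (h1 ▸ Real.exp_le_exp.2 ?_)
    nlinarith
  set S := bz ^ 2 / (σw * ση) with hS
  have hS0 : 0 < S := by positivity
  have hdS : √d * S ≤ 3 / 2 * Λ ^ 2 := by
    refine le_trans ?_ hΛS
    exact le_mul_of_one_le_right (by positivity) hM1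
  set p : ℝ := 1 / (18 * M ^ 2) with hp
  have hp0 : 0 < p := by positivity
  have hpw : p ≤ σw ^ 2 / (18 * wmax ^ 2) := by
    have : σw ^ 2 / (18 * wmax ^ 2) = 1 / (18 * (wmax / σw) ^ 2) := by field_simp
    rw [this, hp]; gcongr
  have hpη : p ≤ ση ^ 2 / (18 * ηmax ^ 2) := by
    have : ση ^ 2 / (18 * ηmax ^ 2) = 1 / (18 * (ηmax / ση) ^ 2) := by field_simp
    rw [this, hp]; gcongr
  have hΛsq : (2 : ℝ) ^ 2 ≤ Λ ^ 2 := by gcongr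
  have hΛpow : (2 : ℝ) ^ 7 ≤ Λ ^ 7 := by gcongr
  have hΛpow' : (2 : ℝ) ^ 12 ≤ Λ ^ 12 := by gcongr
  have hc₁ : 48 * √d * S + 3 ≤ Λ ^ 9 := by
    have : Λ ^ 9 = Λ ^ 2 * Λ ^ 7 := by ring
    rw [this]
    have := mul_le_mul_of_nonneg_left hΛpow (sq_nonneg Λ)
    linarith
  have hc₂ : 2 * √d * (1152 * S * M) + 3 ≤ Λ ^ 14 := by
    have : Λ ^ 14 = Λ ^ 2 * Λ ^ 12 := by ring
    rw [this]
    have := mul_le_mul_of_nonneg_left hΛpow' (sq_nonneg Λ)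
    linarith
  -- The exponent 11 pays 9 for the net (cardinality at most Λ^(9d)) and leaves 2 for exp(-2dL) ≤ δ.
  -- As p/8 = 1/(144 M²), this needs T ≥ 1584 d M² L.
  have hTp : 11 * (d * L) ≤ T * p / 8 := by
    have h0 : 0 ≤ d * M ^ 2 * L := by positivity
    calc 11 * (d * L) = 1584 * (d * M ^ 2 * L) * p / 8 := by
          rw [hp]; field_simp; norm_num
      _ ≤ T * p / 8 := by gcongr; linarith
  obtain ⟨bad₁, hbad₁, hexc⟩ := h.exists_excitation_event (δ := δ) hp0.le hpw hpη hT2 hc₁ (by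
    have h1 := pow_le_exp_mul_log (k := 9) (d := n + m) (by positivity : 0 ≤ Λ ^ 9) hΛ0 le_rfl
    rw [hdcast, ← hL] at h1
    calc _ ≤ Real.exp ((9 : ℕ) * (d * L)) * Real.exp (-(11 * (d * L))) := by gcongr
      _ = Real.exp (-(2 * (d * L))) := by rw [← Real.exp_add]; congr 1; push_cast; ring
      _ ≤ δ := hδexp)
  set l : ℝ := √T * (σw * ση / (6 * bz)) / (48 * M) with hl
  have hl0 : 0 < l := by positivity
  have hl2 : T * p / 8 * ((σw * ση / (6 * bz)) ^ 2 / 16) = l ^ 2 := by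
    have hTs : √(T : ℝ) ^ 2 = T := Real.sq_sqrt (by linarith)
    rw [hl, div_pow (√(T : ℝ) * _), mul_pow (√(T : ℝ)), hTs, hp]
    field_simp
    norm_num
  have : Nonempty (Fin n ⊕ Fin m) := ⟨Sum.inl ⟨0, h.one_le_state⟩⟩
  -- The factor √T cancels in the ratio of radius to mesh, which equals 1152 S M.
  obtain ⟨N, hcard, hN⟩ := exists_finset_net (Fin n ⊕ Fin m) (R := 1 / l)
    (ε := 1 / (4 * √T * bz)) (by positivity)
  have hcardN : (N.card : ℝ) ≤ Real.exp (14 * (d * L)) := by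
    have h1 := pow_le_exp_mul_log (k := 14) (d := n + m)
      (by positivity : 0 ≤ 2 * √d * (1152 * S * M) + 3) hΛ0 hc₂
    rw [hdcast, ← hL] at h1
    refine (hcard (by positivity)).trans (le_trans (le_of_eq ?_) h1)
    rw [Fintype.card_sum, Fintype.card_fin, Fintype.card_fin, hdcast]
    congr 3
    rw [hl, hS]
    field_simp
    norm_num
  have hnexp : (n : ℝ) ≤ Real.exp (d * L) := by
    have h1 : (2 : ℝ) ^ n ≤ Real.exp ((1 : ℕ) * (n * Real.log Λ)) :=
      pow_le_exp_mul_log (by norm_num) hΛ0 (by simpa using hΛ2)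
    have h2 : (n : ℝ) ≤ 2 ^ n := by exact_mod_cast Nat.lt_two_pow_self.le
    refine h2.trans (h1.trans (Real.exp_le_exp.2 ?_))
    rw [← hL]
    push_cast
    nlinarith
  -- The exponent 17 pays 14 for the net and 1 for the union over the n rows, and leaves 2 for δ.
  obtain ⟨bad₂, hbad₂, hmart⟩ := h.exists_martingale_event T N (q := d * L) (δ := δ) (by linarith) (by
    calc _ ≤ Real.exp (d * L) * (Real.exp (14 * (d * L)) * Real.exp (-(17 * (d * L)))) := by
          gcongr
      _ = Real.exp (-(2 * (d * L))) := by
          rw [← Real.exp_add, ← Real.exp_add]; congr 1; ring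
      _ ≤ δ := hδexp)
  refine ⟨{ω | ¬ ∀ t, √(‖x t ω‖ ^ 2 + ‖u t ω‖ ^ 2) ≤ bz} ∪ (bad₁ ∪ bad₂), ?_, ?_⟩
  · have h0 : μ {ω | ¬ ∀ t, √(‖x t ω‖ ^ 2 + ‖u t ω‖ ^ 2) ≤ bz} = 0 := h.bounded
    refine (measure_union_le _ _).trans ?_
    rw [h0, zero_add, two_mul, ENNReal.ofReal_add hδ.le hδ.le]
    exact (measure_union_le _ _).trans (add_le_add hbad₁ hbad₂)
  · intro ω hω Ahat Bhat hLSE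
    simp only [Set.mem_union, not_or, Set.mem_ofPred_eq, not_not] at hω
    obtain ⟨hbd, hω₁, hω₂⟩ := hω
    refine l2_opNorm_le_of_rows (by positivity) fun i => ?_
    rw [le_div_iff₀ hl0, mul_comm]
    refine norm_le_of_normal_equation (by lia) (g := fun s => w s ω i)
      (z := fun s => joinVec (x s ω) (u s ω)) hbz hl0 (by positivity)
      (fun s => by rw [norm_joinVec]; exact hbd s)
      (hLSE.normal_equation (w := fun t => w t ω) (fun t => h.loop.state t ω) i) ?_ hN
      (fun v hv => hmart ω hω₂ i v hv)
    intro v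
    rw [← hl2]
    exact hexc ω hω₁ hbd v

end IsBoundedLoop

end SysId

/-! ### The theorem with explicit constants -/

theorem theorem1 :
    ∃ c₁ > (0 : ℝ), ∃ c₂ > (0 : ℝ),
      ∀ (n m : ℕ) (_ : 1 ≤ n) (_ : 1 ≤ m)
        (Ω : Type*) [MeasurableSpace Ω] (μ : Measure Ω) [IsProbabilityMeasure μ]
        (A : Matrix (Fin n) (Fin n) ℝ) (B : Matrix (Fin n) (Fin m) ℝ)
        (π : SysId.Policy n m) (_ : ∀ t, Measurable (π t))
        (w : ℕ → Ω → SysId.Vec n) (η : ℕ → Ω → SysId.Vec m)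
        (x : ℕ → Ω → SysId.Vec n) (u : ℕ → Ω → SysId.Vec m)
        (wmax σw ηmax ση bz wbar ηbar : ℝ)
        -- the noises, with mutual independence of the initial state and all `w_t`, `η_t`
        (_ : SysId.IsBoundedNoise μ w wmax σw) (_ : SysId.IsBoundedNoise μ η ηmax ση)
        (_ : Measurable (x 0))
        (_ : IndepFun (fun ω t => w t ω) (fun ω t => η t ω) μ)
        (_ : IndepFun (x 0) (fun ω => ((fun t => w t ω), (fun t => η t ω))) μ)
        -- the closed loop, with bounded trajectories
        (_ : SysId.IsClosedLoop A B π w η x u)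
        (_ : ∀ᵐ ω ∂μ, ∀ t, √(‖x t ω‖ ^ 2 + ‖u t ω‖ ^ 2) ≤ bz)
        (_ : wbar = wmax / σw) (_ : ηbar = ηmax / ση)
        (δ : ℝ) (_ : 0 < δ) (_ : δ < 1 / 3) (T : ℕ)
        (_ : c₁ * (((m : ℝ) + n) * max (wbar ^ 4) (ηbar ^ 4) *
          Real.log (bz / δ * SysId.poly₁ wbar ηbar σw ση)) ≤ T),
        ∃ G : Set Ω, MeasurableSet G ∧ 1 - 3 * δ ≤ μ.real G ∧
          ∀ ω ∈ G, ∀ (Ahat : Matrix (Fin n) (Fin n) ℝ) (Bhat : Matrix (Fin n) (Fin m) ℝ),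
            SysId.IsLSE T (fun t => x t ω) (fun t => u t ω) Ahat Bhat →
            ‖Matrix.fromCols Ahat Bhat - Matrix.fromCols A B‖ ≤
              c₂ * (bz * √((m : ℝ) + n) / (√(T : ℝ) * ση) * SysId.poly₂ wbar ηbar σw ση *
                √(Real.log (bz / δ) + Real.log (SysId.poly₁ wbar ηbar σw ση))) := by
  -- 6912 = 24 · 48 · 6: the self-normalized bound, the constant in l, and the hitting scale.
  refine ⟨2000, by norm_num, 6912, by norm_num, ?_⟩
  intro n m hn hm Ω _ μ _ A B π hπ w η x u wmax σw ηmax ση bz wbar ηbar hw hη hx₀ hind hind₀ hloop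
    hbd hwbar hηbar δ hδ hδ' T hT
  subst hwbar hηbar
  have h : SysId.IsBoundedLoop μ A B π w η x u wmax σw ηmax ση bz :=
    ⟨hn, hm, hπ, hw, hη, hx₀, hind, hind₀, hloop, hbd⟩
  have hσw := hw.sigma_pos
  have hση := hη.sigma_pos
  have hwpos := hw.pos hn
  have hηpos := hη.pos hm
  have hbz : 0 < bz := by linarith [h.sigma_state_le]
  have hn1 : (1 : ℝ) ≤ n := by exact_mod_cast hn
  have hm1 : (1 : ℝ) ≤ m := by exact_mod_cast hm
  have hna : (n : ℝ) ≤ (wmax / σw) ^ 2 := by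
    rw [div_pow, le_div_iff₀ (by positivity)]; exact hw.card_mul_sq_le
  have hmb : (m : ℝ) ≤ (ηmax / ση) ^ 2 := by
    rw [div_pow, le_div_iff₀ (by positivity)]; exact hη.card_mul_sq_le
  obtain ⟨a, hwa⟩ : ∃ a, a = wmax / σw := ⟨_, rfl⟩
  obtain ⟨b, hηb⟩ : ∃ b, b = ηmax / ση := ⟨_, rfl⟩
  have ha : 0 < a := by rw [hwa]; positivity
  have hb : 0 < b := by rw [hηb]; positivity
  have hbad := h.exists_bad_event hδ hδ' rfl rfl (T := T)
  rw [← hwa] at hna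
  rw [← hηb] at hmb
  rw [← hwa, ← hηb] at hT hbad ⊢
  obtain ⟨hΛ2, -, -, hp⟩ := SysId.log_argument_bounds hσw hση ha hb hn hm hna hmb
    h.sigma_state_le hδ hδ'
  have ha1 : 1 ≤ a := by nlinarith
  have hb1 : 1 ≤ b := by nlinarith
  have haM : a ≤ max a b := le_max_left _ _
  have hbM : b ≤ max a b := le_max_right _ _
  have hM1 : 1 ≤ max a b := ha1.trans haM
  have hL : 0 < Real.log (bz / δ * SysId.poly₁ a b σw ση) := Real.log_pos (by linarith)
  have hMpow : max a b ^ 2 ≤ max (a ^ 4) (b ^ 4) := by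
    rcases max_choice a b with hmax | hmax <;> rw [hmax]
    · exact (pow_le_pow_right₀ ha1 (by norm_num)).trans (le_max_left _ _)
    · exact (pow_le_pow_right₀ hb1 (by norm_num)).trans (le_max_right _ _)
  obtain ⟨bad, hbadμ, hbound⟩ := hbad (le_trans (by gcongr) hT)
  -- The bad set need not be measurable, so its measurable hull is removed; this still leaves
  -- probability at least 1 - 2δ.
  refine ⟨(toMeasurable μ bad)ᶜ, (measurableSet_toMeasurable μ bad).compl, ?_, ?_⟩
  · rw [probReal_compl_eq_one_sub (measurableSet_toMeasurable μ bad)]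
    have : μ.real (toMeasurable μ bad) ≤ 2 * δ := by
      rw [measureReal_def, measure_toMeasurable]
      exact ENNReal.toReal_le_of_le_ofReal (by positivity) hbadμ
    linarith
  · intro ω hω Ahat Bhat hLSE
    refine (hbound ω (fun hmem => hω (subset_toMeasurable μ bad hmem)) Ahat Bhat hLSE).trans ?_
    rw [← Real.log_mul (by positivity) (by positivity)]
    set L := Real.log (bz / δ * SysId.poly₁ a b σw ση) with hLdef
    have hd0 : (0 : ℝ) ≤ (m : ℝ) + n := by positivity
    have hTpos : (0 : ℝ) < T := by
      refine lt_of_lt_of_le ?_ hT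
      have : 0 < max (a ^ 4) (b ^ 4) := lt_of_lt_of_le (by positivity) (le_max_left _ _)
      positivity
    have hsn : √(n : ℝ) ≤ a := Real.sqrt_le_iff.2 ⟨ha.le, hna⟩
    have hwmax : wmax = a * σw := by rw [hwa]; field_simp
    have e : √(n : ℝ) * (24 * (wmax * √(((m : ℝ) + n) * L)) /
        (√T * (σw * ση / (6 * bz)) / (48 * max a b))) =
        6912 * (bz * √((m : ℝ) + n) / (√T * ση) * (a * (max a b * √(n : ℝ))) * √L) := by
      rw [Real.sqrt_mul hd0, hwmax]
      field_simp
      norm_num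
    rw [e]
    -- The dimension factor √n ≤ a is absorbed by the last maximum in `poly₂`, using b ≥ 1.
    have hpoly : a * (max a b * √(n : ℝ)) ≤ SysId.poly₂ a b σw ση := by
      rw [SysId.poly₂, mul_assoc]
      have h1 : max a b ≤ max (a ^ 2) (b ^ 2) := by
        refine max_le_max ?_ ?_ <;> nlinarith
      have h2 : √(n : ℝ) ≤ max (max (a * ση) (b * σw)) (a * b) := by
        refine (hsn.trans ?_).trans (le_max_right _ _)
        nlinarith
      gcongr
    gcongr
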